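/- Let $(B_\theta)_{\theta\in[0,1]}$ be a standard Brownian motion, and let $(L^a_\theta)_{a\in\mathbb R,\ \theta\in[0,1]}$ be the bicontinuous version of its local time, that is, the family of random variables which almost surely is jointly continuous in $(a,\theta)$, is nondecreasing in $\theta$ with $L^a_0=0$, and satisfies the occupation times formula $$\int_0^\theta \psi(s,B_s)\,ds=\int_{\mathbb R}\int_0^\theta\psi(s,a)\,dL^a_s\,da,\qquad \theta\in[0,1],$$ for all bounded Borel $\psi$. Let $\rho\in C_c^\infty(-1,1)$ satisfy $\rho\ge 0$, $\int_{\mathbb R}\rho\,dx=1$ and $\rho(x)=\rho(-x)$, and for $\epsilon>0$ put $\rho_\epsilon=\frac1\epsilon\rho(\cdot/\epsilon)$, $$\dot B_{\epsilon,\theta}=\frac{d}{d\theta}\int_0^1\rho_\epsilon(\sigma-\theta)\,B_\sigma\,d\sigma,\qquad :\!\dot B_{\epsilon,\theta}^2\!:\;=\dot B_{\epsilon,\theta}^2-\mathbb E\big[\dot B_{\epsilon,\theta}^2\big].$$ Write $\langle f,g\rangle=\int_0^1 f_\theta g_\theta\,d\theta$, $(Qk)_\theta=\int_0^1(\theta\wedge\sigma)\,k_\sigma\,d\sigma$,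 and $$\lambda(\theta,x,y)=x^2+\frac{xy}{\theta}+\frac{y^2-\theta}{4\theta^2},\qquad \theta\in(0,1),\ x,y\in\mathbb R.$$ Then for all $a\in\mathbb R$, all continuous $h$ with compact support in $(0,1)$, and all continuous $k:[0,1]\to\mathbb R$ with $k_0=0$, setting $K=Qk$: the random variables $e^{\langle B,k\rangle}\int_0^1 h_\theta:\!\dot B_{\epsilon,\theta}^2\!:dL^a_\theta$ are integrable for every $\epsilon>0$, their expectations converge as $\epsilon\downarrow0$, and $$\mathbb E\Big[e^{\langle B,k\rangle}\int_0^1 h_\theta:\!\dot B_\theta^2\!:dL^a_\theta\Big]:=\lim_{\epsilon\downarrow0}\mathbb E\Big[e^{\langle B,k\rangle}\int_0^1 h_\theta:\!\dot B_{\epsilon,\theta}^2\!:dL^a_\theta\Big] =e^{\frac12\langle Qk,k\rangle}\int_0^1 h_\theta\,\frac{e^{-(a-K_\theta)^2/(2\theta)}}{\sqrt{2\pi\theta}}\,\lambda(\theta,K'_\theta,a-K_\theta)\,d\theta .$$ In particular the limit does not depend on the choice of $\rho$. -/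

import Mathlib

open MeasureTheory ProbabilityTheory Set Filter Topology


namespace RenormalizedWhiteNoise

noncomputable section

/-- Standard Brownian motion `(B_θ : θ ∈ [0,1])`: a centred Gaussian process with covariance
`θ ∧ θ'` and almost surely continuous paths.  Processes and functions on `[0,1]` are written as
functions on `ℝ`; only their values on `[0,1]` are ever used. -/
structure IsBrownianOnUnit {Ω : Type*} [MeasurableSpace Ω] (B : ℝ → Ω → ℝ) (P : Measure Ω) :
    Prop where
  gaussian : IsGaussianProcess (fun (θ : Icc (0 : ℝ) 1) ω => B θ ω) P
  mean : ∀ θ ∈ Icc (0 : ℝ) 1, ∫ ω, B θ ω ∂P = 0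
  cov : ∀ θ ∈ Icc (0 : ℝ) 1, ∀ θ' ∈ Icc (0 : ℝ) 1, cov[B θ, B θ'; P] = min θ θ'
  cont : ∀ᵐ ω ∂P, ContinuousOn (fun θ => B θ ω) (Icc 0 1)

/-- Mathlib's Brownian motion on `[0,∞)`, restricted to `[0,1]`, is a Brownian motion in the
above sense. -/
theorem isBrownianOnUnit_of_isBrownianReal {Ω : Type*} [MeasurableSpace Ω] {P : Measure Ω}
    {B : NNReal → Ω → ℝ} (hB : IsBrownianReal B P) :
    IsBrownianOnUnit (fun θ ω => B θ.toNNReal ω) P where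
  gaussian := hB.toIsPreBrownianReal.isGaussianProcess.comp_right
    (fun θ : Icc (0 : ℝ) 1 => (θ : ℝ).toNNReal)
  mean θ _ := hB.toIsPreBrownianReal.integral_eval _
  cov θ hθ θ' hθ' := by
    have h := hB.toIsPreBrownianReal.covariance_eval θ.toNNReal θ'.toNNReal
    simpa [Real.coe_toNNReal, hθ.1, hθ'.1] using h
  cont := by
    filter_upwards [hB.cont] with ω hω
    exact (hω.comp continuous_real_toNNReal).continuousOn

/-- The Lebesgue–Stieltjes measure `df` of a function `f` that is nondecreasing on `[0,1]`
(`f` is extended to `ℝ` by the constants `f 0` and `f 1`); the zero measure for other `f`. -/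
def stieltjesMeasure (f : ℝ → ℝ) : Measure ℝ :=
  open Classical in
  if hf : MonotoneOn f (Icc 0 1) then
    (Monotone.stieltjesFunction
      (f := fun x : ℝ => f (projIcc 0 1 zero_le_one x))
      (fun _ _ hxy => hf (projIcc 0 1 zero_le_one _).2 (projIcc 0 1 zero_le_one _).2
        (monotone_projIcc zero_le_one hxy))).measure
  else 0

/-- `L a θ ω` is (the bicontinuous version of) the local time `L^a_θ` of `B` on `[0,1]`: almost
surely it is jointly continuous in `(a, θ)`, nondecreasing in `θ` and zero at `θ = 0`, and it
satisfies the occupation times formula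
`∫_0^θ ψ(s, B_s) ds = ∫_ℝ ∫_0^θ ψ(s, a) dL^a_s da` for all bounded Borel `ψ`.
These properties determine `L` up to indistinguishability. -/
structure IsLocalTime {Ω : Type*} [MeasurableSpace Ω] (B : ℝ → Ω → ℝ) (L : ℝ → ℝ → Ω → ℝ)
    (P : Measure Ω) : Prop where
  aemeasurable : ∀ a, ∀ θ ∈ Icc (0 : ℝ) 1, AEMeasurable (L a θ) P
  cont : ∀ᵐ ω ∂P, ContinuousOn (fun p : ℝ × ℝ => L p.1 p.2 ω) (univ ×ˢ Icc 0 1)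
  mono : ∀ᵐ ω ∂P, ∀ a, MonotoneOn (fun θ => L a θ ω) (Icc 0 1)
  zero : ∀ᵐ ω ∂P, ∀ a, L a 0 ω = 0
  occupation : ∀ᵐ ω ∂P, ∀ ψ : ℝ × ℝ → ℝ, Measurable ψ → (∃ M, ∀ p, |ψ p| ≤ M) →
    ∀ θ ∈ Icc (0 : ℝ) 1,
      ∫ s in (0 : ℝ)..θ, ψ (s, B s ω) =
        ∫ a : ℝ, ∫ s in Ioc 0 θ, ψ (s, a) ∂(stieltjesMeasure fun θ => L a θ ω)

/-- A symmetric smooth mollifier profile supported in `(-1,1)`. -/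
structure IsMollifier (ρ : ℝ → ℝ) : Prop where
  smooth : ContDiff ℝ ((⊤ : ℕ∞) : WithTop ℕ∞) ρ
  support : tsupport ρ ⊆ Ioo (-1) 1
  nonneg : ∀ x, 0 ≤ ρ x
  integral : ∫ x, ρ x = 1
  symm : ∀ x, ρ (-x) = ρ x

/-- `ρ_ε(x) = ρ(x/ε)/ε`. -/
def scaled (ρ : ℝ → ℝ) (ε x : ℝ) : ℝ := (1 / ε) * ρ (x / ε)

/-- The regularisation `ℓ_{ε,θ} = ∫_0^1 ρ_ε(σ - θ) ℓ_σ dσ`. -/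
def regularize (ρ : ℝ → ℝ) (ε : ℝ) (ℓ : ℝ → ℝ) (θ : ℝ) : ℝ :=
  ∫ σ in (0 : ℝ)..1, scaled ρ ε (σ - θ) * ℓ σ

/-- `Ḃ_{ε,θ}`, the derivative in `θ` of the regularised path. -/
def regDeriv {Ω : Type*} (ρ : ℝ → ℝ) (ε : ℝ) (B : ℝ → Ω → ℝ) (θ : ℝ) (ω : Ω) : ℝ :=
  deriv (regularize ρ ε (fun σ => B σ ω)) θ

/-- `:Ḃ_{ε,θ}²: = Ḃ_{ε,θ}² - E[Ḃ_{ε,θ}²]`. -/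
def wickSq {Ω : Type*} [MeasurableSpace Ω] (P : Measure Ω) (ρ : ℝ → ℝ) (ε : ℝ)
    (B : ℝ → Ω → ℝ) (θ : ℝ) (ω : Ω) : ℝ :=
  regDeriv ρ ε B θ ω ^ 2 - ∫ ω', regDeriv ρ ε B θ ω' ^ 2 ∂P

/-- `∫_0^1 h_θ :Ḃ_{ε,θ}²: dL^a_θ`. -/
def wickLocalTimeIntegral {Ω : Type*} [MeasurableSpace Ω] (P : Measure Ω) (ρ : ℝ → ℝ) (ε : ℝ)
    (B : ℝ → Ω → ℝ) (L : ℝ → ℝ → Ω → ℝ) (h : ℝ → ℝ) (a : ℝ) (ω : Ω) : ℝ :=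
  ∫ θ in Icc (0 : ℝ) 1, h θ * wickSq P ρ ε B θ ω ∂(stieltjesMeasure fun θ => L a θ ω)

/-- The functional `F ↦ E[F(B) ∫_0^1 h_θ :Ḃ_θ²: dL^a_θ]` is defined at `F` and has the value `v`:
for every mollifier `ρ`, the variables `F(B) ∫_0^1 h_θ :Ḃ_{ε,θ}²: dL^a_θ` are integrable and
their expectations tend to `v` as `ε ↓ 0`. -/
def HasRenormalizedExpectation {Ω : Type*} [MeasurableSpace Ω] (P : Measure Ω)
    (B : ℝ → Ω → ℝ) (L : ℝ → ℝ → Ω → ℝ) (h : ℝ → ℝ) (a : ℝ) (F : (ℝ → ℝ) → ℝ) (v : ℝ) : Prop :=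
  ∀ ρ : ℝ → ℝ, IsMollifier ρ →
    (∀ ε > 0, Integrable
      (fun ω => F (fun θ => B θ ω) * wickLocalTimeIntegral P ρ ε B L h a ω) P) ∧
    Tendsto
      (fun ε => ∫ ω, F (fun θ => B θ ω) * wickLocalTimeIntegral P ρ ε B L h a ω ∂P)
      (𝓝[>] 0) (𝓝 v)

/-- The scalar product of `L²(0,1)`. -/
def scalarProd (f g : ℝ → ℝ) : ℝ := ∫ θ in (0 : ℝ)..1, f θ * g θ

/-- The operator `(Qk)_θ = ∫_0^1 (θ ∧ σ) k_σ dσ`. -/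
def covOp (k : ℝ → ℝ) (θ : ℝ) : ℝ := ∫ σ in (0 : ℝ)..1, min θ σ * k σ

/-- `λ(θ, x, y) = x² + x y / θ + (y² - θ) / (4 θ²)`. -/
def lam (θ x y : ℝ) : ℝ := x ^ 2 + x * y / θ + (y ^ 2 - θ) / (4 * θ ^ 2)

end

end RenormalizedWhiteNoise

/-! Fix `ε` first. The regularised derivative is a Gaussian linear functional `D = ∫ m_s B` with a
continuous bounded kernel `m_s = derivKernel ρ ε s`, so only the singular measure `dL^a` needs care.
By the occupation times formula and continuity in the level, `dL^a_s` is the limit of `(2δ)⁻¹ 1{a-δ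
< B_s ≤ a+δ} ds` against continuous compactly supported integrands (`IsLocalTime.tendsto_average`).
Expectations pass to this limit because the approximants are dominated by a fixed `L²` variable
(`IsRegularBrownian.memLp_exp_mul`) times occupation densities bounded in `L²` uniformly in `δ`
(`IsRegularBrownian.eLpNorm_occupationDensity_le`).

For one time `s` the expectation is explicit. Tilting by `exp ⟨B,k⟩` leaves the covariance of `(D,
B_s)` unchanged and shifts its mean to `(⟨Qk, m_s⟩, K_s)` (`IsRegularBrownian.map_tilted`).
Regressing `D` on `B_s`, with `C = E[D B_s]`, gives `E[D² - V | B_s = z] = (κ + C (z - K_s) / s)² -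
C² / s` (`integral_indicator_mul_sq_sub`): the diverging variance `V` has cancelled. Letting `δ → 0`
yields an exact formula at each `ε` (`IsRegularBrownian.integral_exp_mul_wickIntegral`).

As `ε → 0` only `κ` and `C` depend on `ε`. Here `κ = ⟨Qk, m_s⟩` is a mollification of `K'` and tends
to `K'_s`, while `C = 1/2` exactly once `ε ≤ s ≤ 1 - ε`, by symmetry of `ρ`
(`IsMollifier.covOp_derivKernel`). Since `(x + y/(2θ))² - 1/(4θ) = λ(θ, x, y)`, dominated
convergence in `s` finishes the proof (`IsMollifier.tendsto_integral_wickDensity`). -/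

namespace RenormalizedWhiteNoise
open scoped NNReal ENNReal

/-! ### Riemann sums on `[0,1]`. -/

section RiemannSums

/-- The left endpoint of the cell of the uniform grid of mesh `1/n` that contains `x`. -/
noncomputable def gridPoint (n : ℕ) (x : ℝ) : ℝ := (⌊(n : ℝ) * x⌋ : ℝ) / n

lemma measurable_gridPoint (n : ℕ) : Measurable (gridPoint n) := by
  unfold gridPoint
  have : Measurable (fun x : ℝ => (⌊(n : ℝ) * x⌋ : ℝ)) :=
    (measurable_of_countable (fun z : ℤ => (z : ℝ))).comp
      (Int.measurable_floor.comp (measurable_const_mul _))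
  exact this.div_const _

lemma gridPoint_mem_Icc (n : ℕ) {x : ℝ} (hx : x ∈ Icc (0 : ℝ) 1) :
    gridPoint n x ∈ Icc (0 : ℝ) 1 := by
  have hn : (0 : ℝ) ≤ n := Nat.cast_nonneg n
  have h0 : (0 : ℤ) ≤ ⌊(n : ℝ) * x⌋ := Int.floor_nonneg.2 (mul_nonneg hn hx.1)
  refine ⟨div_nonneg (by exact_mod_cast h0) hn, ?_⟩
  refine div_le_one_of_le₀ ((Int.floor_le _).trans ?_) hn
  nlinarith [hx.2]

lemma tendsto_gridPoint (x : ℝ) : Tendsto (fun n => gridPoint n x) atTop (𝓝 x) := by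
  have h1 : Tendsto (fun n : ℕ => x - 1 / (n : ℝ)) atTop (𝓝 x) := by
    simpa using (tendsto_const_nhds (x := x)).sub (tendsto_one_div_atTop_nhds_zero_nat (𝕜 := ℝ))
  refine tendsto_of_tendsto_of_tendsto_of_le_of_le' h1 tendsto_const_nhds ?_ ?_
  all_goals
    filter_upwards [eventually_ne_atTop 0] with n hn
    have hn0 : (0 : ℝ) < n := by positivity
    unfold gridPoint
  · rw [le_div_iff₀ hn0, sub_mul, one_div, inv_mul_cancel₀ hn0.ne', mul_comm]
    linarith [Int.sub_one_lt_floor ((n : ℝ) * x)]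
  · rw [div_le_iff₀ hn0, mul_comm]
    simpa [mul_comm] using Int.floor_le ((n : ℝ) * x)

/-- The integrand is constant on each open cell, so this is a left Riemann sum; in integral form its
convergence is mere dominated convergence. -/
lemma integral_comp_gridPoint (f : ℝ → ℝ) {n : ℕ} (hn : n ≠ 0) :
    ∫ x in (0 : ℝ)..1, f (gridPoint n x) = ∑ i ∈ Finset.range n, 1 / (n : ℝ) * f (i / n) := by
  have hn0 : (0 : ℝ) < n := by positivity
  have hcell : ∀ i : ℕ, ∀ x ∈ Ioo ((i : ℝ) / n) ((i + 1 : ℕ) / n),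
      f (gridPoint n x) = f (i / n) := by
    intro i x hx
    have : ⌊(n : ℝ) * x⌋ = (i : ℤ) := by
      rw [Int.floor_eq_iff]
      have h1 := hx.1
      have h2 := hx.2
      rw [div_lt_iff₀ hn0] at h1
      rw [lt_div_iff₀ hn0] at h2
      push_cast at h2 ⊢
      constructor <;> linarith [mul_comm x (n : ℝ)]
    simp [gridPoint, this]
  have hle : ∀ i : ℕ, (i : ℝ) / n ≤ (i + 1 : ℕ) / n := fun i => by
    gcongr; exact_mod_cast i.le_succ
  have hae : ∀ i : ℕ, ∀ᵐ x, x ∈ uIoc ((i : ℝ) / n) ((i + 1 : ℕ) / n) →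
      f (i / n) = f (gridPoint n x) := by
    intro i
    have : ∀ᵐ x : ℝ, x ≠ ((i + 1 : ℕ) : ℝ) / n := by simp [ae_iff]
    filter_upwards [this] with x hx hmem
    rw [uIoc_of_le (hle i)] at hmem
    exact (hcell i x ⟨hmem.1, lt_of_le_of_ne hmem.2 hx⟩).symm
  have hint : ∀ i < n, IntervalIntegrable (fun x => f (gridPoint n x)) volume
      ((i : ℝ) / n) ((i + 1 : ℕ) / n) := by
    intro i _
    refine (intervalIntegrable_const (c := f (i / n))).congr_ae ?_
    exact (ae_restrict_iff' measurableSet_uIoc).2 (hae i)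
  have := intervalIntegral.sum_integral_adjacent_intervals (a := fun i : ℕ => (i : ℝ) / n) hint
  simp only [Nat.cast_zero, zero_div, div_self hn0.ne'] at this
  rw [← this]
  refine Finset.sum_congr rfl fun i _ => ?_
  rw [← intervalIntegral.integral_congr_ae (hae i), intervalIntegral.integral_const, smul_eq_mul]
  congr 1
  push_cast
  field_simp
  ring

lemma tendsto_integral_comp_gridPoint {f : ℝ → ℝ} (hf : Continuous f) :
    Tendsto (fun n => ∫ x in (0 : ℝ)..1, f (gridPoint n x)) atTop (𝓝 (∫ x in (0 : ℝ)..1, f x)) := by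
  obtain ⟨C, hC⟩ := isCompact_Icc.exists_bound_of_continuousOn (hf.continuousOn (s := Icc (0:ℝ) 1))
  refine intervalIntegral.tendsto_integral_filter_of_dominated_convergence (fun _ => C) ?_ ?_ ?_ ?_
  · exact Eventually.of_forall fun n =>
      (hf.measurable.comp (measurable_gridPoint n)).aestronglyMeasurable
  · refine Eventually.of_forall fun n => Eventually.of_forall fun x hx => ?_
    rw [uIoc_of_le zero_le_one] at hx
    exact hC _ (gridPoint_mem_Icc n (Ioc_subset_Icc_self hx))
  · exact intervalIntegrable_const
  · exact Eventually.of_forall fun x _ => (hf.tendsto x).comp (tendsto_gridPoint x)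

lemma tendsto_double_integral_comp_gridPoint {G : ℝ → ℝ → ℝ} (hG : Continuous (Function.uncurry G)) :
    Tendsto (fun n => ∫ x in (0 : ℝ)..1, ∫ y in (0 : ℝ)..1, G (gridPoint n x) (gridPoint n y)) atTop
      (𝓝 (∫ x in (0 : ℝ)..1, ∫ y in (0 : ℝ)..1, G x y)) := by
  obtain ⟨C, hC⟩ := (isCompact_Icc.prod isCompact_Icc).exists_bound_of_continuousOn
    (hG.continuousOn (s := Icc (0:ℝ) 1 ×ˢ Icc (0:ℝ) 1))
  have hb : ∀ n, ∀ x ∈ Icc (0:ℝ) 1, ∀ y ∈ Icc (0:ℝ) 1,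
      ‖G (gridPoint n x) (gridPoint n y)‖ ≤ C := fun n x hx y hy =>
    hC (gridPoint n x, gridPoint n y) ⟨gridPoint_mem_Icc n hx, gridPoint_mem_Icc n hy⟩
  have hm : ∀ n, Measurable (Function.uncurry fun x y => G (gridPoint n x) (gridPoint n y)) :=
    fun n => hG.measurable.comp (((measurable_gridPoint n).comp measurable_fst).prodMk
      ((measurable_gridPoint n).comp measurable_snd))
  refine intervalIntegral.tendsto_integral_filter_of_dominated_convergence (fun _ => C) ?_ ?_ ?_ ?_
  · refine Eventually.of_forall fun n => ?_
    simp_rw [intervalIntegral.integral_of_le zero_le_one]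
    exact (hm n).stronglyMeasurable.integral_prod_right.aestronglyMeasurable
  · refine Eventually.of_forall fun n => Eventually.of_forall fun x hx => ?_
    rw [uIoc_of_le zero_le_one] at hx
    have := intervalIntegral.norm_integral_le_of_norm_le_const (a := (0:ℝ)) (b := 1) (C := C)
      (f := fun y => G (gridPoint n x) (gridPoint n y)) (fun y hy => by
        rw [uIoc_of_le zero_le_one] at hy
        exact hb n x (Ioc_subset_Icc_self hx) y (Ioc_subset_Icc_self hy))
    simpa using this
  · exact intervalIntegrable_const
  · refine Eventually.of_forall fun x hx => ?_
    rw [uIoc_of_le zero_le_one] at hx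
    refine intervalIntegral.tendsto_integral_filter_of_dominated_convergence (fun _ => C) ?_ ?_ ?_ ?_
    · exact Eventually.of_forall fun n => ((hm n).comp measurable_prodMk_left).aestronglyMeasurable
    · refine Eventually.of_forall fun n => Eventually.of_forall fun y hy => ?_
      rw [uIoc_of_le zero_le_one] at hy
      exact hb n x (Ioc_subset_Icc_self hx) y (Ioc_subset_Icc_self hy)
    · exact intervalIntegrable_const
    · refine Eventually.of_forall fun y _ => ?_
      exact (hG.tendsto (x, y)).comp ((tendsto_gridPoint x).prodMk_nhds (tendsto_gridPoint y))

end RiemannSums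

/-! ### Recognising Gaussian laws. -/

section Gaussian

variable {Ω : Type*} [MeasurableSpace Ω] {μ : Measure Ω}

/-- A real moment generating function finite everywhere extends analytically to the whole complex
plane, and the complex one determines the law. -/
lemma map_eq_gaussianReal_of_mgf [IsProbabilityMeasure μ] {X : Ω → ℝ} (hX : AEMeasurable X μ)
    {m : ℝ} {v : ℝ≥0} (h : ∀ t, mgf X μ t = Real.exp (m * t + v * t ^ 2 / 2)) :
    μ.map X = gaussianReal m v := by
  have hmgf : mgf X μ = mgf id (gaussianReal m v) := by
    rw [mgf_id_gaussianReal]; exact funext h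
  have hset := integrableExpSet_eq_of_mgf hmgf
  rw [integrableExpSet_id_gaussianReal] at hset
  have hc := eqOn_complexMGF_of_mgf hmgf
  rw [hset] at hc
  have := Measure.ext_of_complexMGF_eq (μ' := gaussianReal m v) hX aemeasurable_id
    (funext fun z => hc (x := z) (by simp))
  simpa using this

/-- Characteristic functions converge on both sides. A degenerate limit `w = 0` is allowed. -/
lemma map_eq_gaussianReal_of_tendsto [IsProbabilityMeasure μ] {X : ℕ → Ω → ℝ} {Y : Ω → ℝ}
    (hX : ∀ n, Measurable (X n)) (hlim : ∀ ω, Tendsto (fun n => X n ω) atTop (𝓝 (Y ω)))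
    {v : ℕ → ℝ} {w : ℝ} (hv : ∀ n, 0 ≤ v n)
    (hlaw : ∀ n, μ.map (X n) = gaussianReal 0 (v n).toNNReal)
    (hvw : Tendsto v atTop (𝓝 w)) :
    0 ≤ w ∧ μ.map Y = gaussianReal 0 w.toNNReal := by
  have hY : Measurable Y := measurable_of_tendsto_metrizable hX (tendsto_pi_nhds.2 hlim)
  have hw : 0 ≤ w := ge_of_tendsto' hvw hv
  have : IsProbabilityMeasure (μ.map Y) := Measure.isProbabilityMeasure_map hY.aemeasurable
  refine ⟨hw, Measure.ext_of_charFun (funext fun t => ?_)⟩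
  have h1 : ∀ n, charFun (μ.map (X n)) t = ∫ ω, Complex.exp (t * X n ω * Complex.I) ∂μ := by
    intro n
    rw [charFun_apply_real, integral_map (hX n).aemeasurable (by fun_prop)]
  have h2 : charFun (μ.map Y) t = ∫ ω, Complex.exp (t * Y ω * Complex.I) ∂μ := by
    rw [charFun_apply_real, integral_map hY.aemeasurable (by fun_prop)]
  have h3 : Tendsto (fun n => charFun (μ.map (X n)) t) atTop (𝓝 (charFun (μ.map Y) t)) := by
    simp_rw [h1, h2]
    refine tendsto_integral_of_dominated_convergence (fun _ => (1 : ℝ)) ?_ (integrable_const _) ?_ ?_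
    · intro n
      have := hX n
      exact (by fun_prop : Measurable
        (fun ω => Complex.exp (t * X n ω * Complex.I))).aestronglyMeasurable
    · intro n
      refine Eventually.of_forall fun ω => ?_
      rw [← Complex.ofReal_mul, Complex.norm_exp_ofReal_mul_I]
    · refine Eventually.of_forall fun ω => ?_
      have hc : Continuous (fun x : ℝ => Complex.exp (t * x * Complex.I)) := by fun_prop
      exact (hc.tendsto _).comp (hlim ω)
  have h4 : Tendsto (fun n => charFun (gaussianReal 0 (v n).toNNReal) t) atTop
      (𝓝 (charFun (gaussianReal 0 w.toNNReal) t)) := by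
    simp_rw [charFun_gaussianReal]
    refine (Complex.continuous_exp.tendsto _).comp ?_
    refine Tendsto.sub tendsto_const_nhds ?_
    refine Tendsto.div_const (Tendsto.mul_const _ ?_) _
    simp_rw [Real.coe_toNNReal _ (hv _), Real.coe_toNNReal _ hw]
    exact (Complex.continuous_ofReal.tendsto _).comp hvw
  refine tendsto_nhds_unique h3 (h4.congr fun n => ?_)
  rw [hlaw n]

end Gaussian

/-! ### Linear functionals of a regular Brownian motion. -/

/-- A Brownian motion on `[0,1]` all of whose paths are continuous and whose values are measurable. -/
structure IsRegularBrownian {Ω : Type*} [MeasurableSpace Ω] (B : ℝ → Ω → ℝ) (P : Measure Ω) :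
    Prop extends IsBrownianOnUnit B P where
  meas : ∀ θ, Measurable (B θ)
  path : ∀ ω, Continuous (fun θ => B θ ω)

section LinearFunctionals

variable {Ω : Type*} [MeasurableSpace Ω] {P : Measure Ω} {B : ℝ → Ω → ℝ}

/-- Nonnegativity of the double sum is recorded because `toNNReal` would otherwise truncate it. -/
lemma IsBrownianOnUnit.map_sum (hB : IsBrownianOnUnit B P)
    (w t : ℕ → ℝ) (ht : ∀ i, t i ∈ Icc (0 : ℝ) 1) (n : ℕ) :
    0 ≤ ∑ i ∈ Finset.range n, ∑ j ∈ Finset.range n, w i * w j * min (t i) (t j) ∧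
    P.map (fun ω => ∑ i ∈ Finset.range n, w i * B (t i) ω) =
      gaussianReal 0 (∑ i ∈ Finset.range n, ∑ j ∈ Finset.range n,
        w i * w j * min (t i) (t j)).toNNReal := by
  have hg : IsGaussianProcess (fun (i : ℕ) ω => w i * B (t i) ω) P :=
    (hB.gaussian.comp_right (fun i : ℕ => (⟨t i, ht i⟩ : Icc (0 : ℝ) 1))).smul w
  have hp := hg.isProbabilityMeasure
  have hl := hg.hasGaussianLaw_fun_sum (I := Finset.range n)
  have hmem : ∀ i, MemLp (fun ω => w i * B (t i) ω) 2 P :=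
    fun i => (hg.hasGaussianLaw_eval i).memLp_two
  have hmean : ∫ ω, ∑ i ∈ Finset.range n, w i * B (t i) ω ∂P = 0 := by
    rw [integral_finsetSum _ fun i _ => (hmem i).integrable one_le_two]
    refine Finset.sum_eq_zero fun i _ => ?_
    rw [integral_const_mul, hB.mean _ (ht i), mul_zero]
  have hvar : Var[fun ω => ∑ i ∈ Finset.range n, w i * B (t i) ω; P] =
      ∑ i ∈ Finset.range n, ∑ j ∈ Finset.range n, w i * w j * min (t i) (t j) := by
    rw [← covariance_self hl.aemeasurable,
      covariance_fun_sum_fun_sum' (fun i _ => hmem i) (fun i _ => hmem i)]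
    refine Finset.sum_congr rfl fun i _ => Finset.sum_congr rfl fun j _ => ?_
    rw [covariance_const_mul_left, covariance_const_mul_right, hB.cov _ (ht i) _ (ht j)]
    ring
  rw [← hvar]
  refine ⟨variance_nonneg _ _, ?_⟩
  rw [hl.map_eq_gaussianReal, hmean]

/-- `∫_0^1 g_σ B_σ dσ + r B_s`. -/
noncomputable def linFun (B : ℝ → Ω → ℝ) (g : ℝ → ℝ) (r s : ℝ) (ω : Ω) : ℝ :=
  (∫ σ in (0 : ℝ)..1, g σ * B σ ω) + r * B s ω

/-- The variance of `∫_0^1 g_σ B_σ dσ + r B_s`. -/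
noncomputable def linVar (g : ℝ → ℝ) (r s : ℝ) : ℝ :=
  scalarProd (covOp g) g + 2 * r * covOp g s + r ^ 2 * s

lemma IsRegularBrownian.measurable_uncurry (hB : IsRegularBrownian B P) :
    Measurable (Function.uncurry B) :=
  measurable_uncurry_of_continuous_of_measurable hB.path hB.meas

lemma IsRegularBrownian.measurable_linFun (hB : IsRegularBrownian B P) {g : ℝ → ℝ}
    (hg : Continuous g) (r s : ℝ) : Measurable (linFun B g r s) := by
  unfold linFun
  refine Measurable.add ?_ ((hB.meas s).const_mul r)
  simp_rw [intervalIntegral.integral_of_le zero_le_one]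
  have : Measurable (Function.uncurry fun (ω : Ω) (σ : ℝ) => g σ * B σ ω) :=
    (hg.measurable.comp measurable_snd).mul (hB.measurable_uncurry.comp measurable_swap)
  exact this.stronglyMeasurable.integral_prod_right.measurable

lemma scalarProd_covOp (g f : ℝ → ℝ) : scalarProd (covOp g) f =
    ∫ x in (0 : ℝ)..1, ∫ y in (0 : ℝ)..1, f x * g y * min x y := by
  unfold scalarProd covOp
  refine intervalIntegral.integral_congr fun x _ => ?_
  rw [mul_comm, ← intervalIntegral.integral_const_mul]
  exact intervalIntegral.integral_congr fun y _ => by ring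

/-- Riemann sums reduce the claim to finite linear combinations; path continuity gives convergence
of the variables, continuity of `min` that of the variances. -/
lemma IsRegularBrownian.map_linFun [IsProbabilityMeasure P] (hB : IsRegularBrownian B P)
    {g : ℝ → ℝ} (hg : Continuous g) (r : ℝ) {s : ℝ} (hs : s ∈ Icc (0 : ℝ) 1) :
    0 ≤ linVar g r s ∧ P.map (linFun B g r s) = gaussianReal 0 (linVar g r s).toNNReal := by
  -- Indices below `n` carry the grid; index `n` carries the extra term `r * B s`.
  set w : ℕ → ℕ → ℝ := fun n i => if i < n then 1 / (n : ℝ) * g (i / n) else r with hw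
  set t : ℕ → ℕ → ℝ := fun n i => if i < n then (i : ℝ) / n else s with ht
  have htmem : ∀ n i, t n i ∈ Icc (0 : ℝ) 1 := by
    intro n i
    simp only [ht]
    split_ifs with h
    · have hn : (0 : ℝ) < n := by exact_mod_cast (Nat.zero_le i).trans_lt h
      refine ⟨by positivity, ?_⟩
      rw [div_le_one hn]
      exact_mod_cast h.le
    · exact hs
  set v : ℕ → ℝ := fun n => (∫ x in (0 : ℝ)..1, ∫ y in (0 : ℝ)..1,
      g (gridPoint n x) * g (gridPoint n y) * min (gridPoint n x) (gridPoint n y)) +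
      2 * r * (∫ x in (0 : ℝ)..1, min s (gridPoint n x) * g (gridPoint n x)) + r ^ 2 * s with hv
  set X : ℕ → Ω → ℝ := fun n ω =>
    (∫ x in (0 : ℝ)..1, g (gridPoint n x) * B (gridPoint n x) ω) + r * B s ω with hX
  have hXeq : ∀ n, n ≠ 0 → X n = fun ω => ∑ i ∈ Finset.range (n + 1), w n i * B (t n i) ω := by
    intro n hn
    funext ω
    simp only [hX, Finset.sum_range_succ, integral_comp_gridPoint (fun x => g x * B x ω) hn]
    congr 1
    · refine Finset.sum_congr rfl fun i hi => ?_
      simp [hw, ht, Finset.mem_range.1 hi, mul_assoc]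
    · simp [hw, ht]
  have hveq : ∀ n, n ≠ 0 → v n = ∑ i ∈ Finset.range (n + 1), ∑ j ∈ Finset.range (n + 1),
      w n i * w n j * min (t n i) (t n j) := by
    intro n hn
    have h1 : ∀ x : ℝ, ∫ y in (0 : ℝ)..1, g x * g (gridPoint n y) * min x (gridPoint n y) =
        ∑ j ∈ Finset.range n, 1 / (n : ℝ) * (g x * g (j / n) * min x (j / n)) :=
      fun x => integral_comp_gridPoint (fun y => g x * g y * min x y) hn
    simp only [hv, h1]
    rw [integral_comp_gridPoint (fun x => ∑ j ∈ Finset.range n,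
      1 / (n : ℝ) * (g x * g (j / n) * min x (j / n))) hn,
      integral_comp_gridPoint (fun x => min s x * g x) hn]
    simp only [Finset.sum_range_succ, Finset.sum_add_distrib]
    have e1 : ∀ i ∈ Finset.range n, ∑ j ∈ Finset.range n, w n i * w n j * min (t n i) (t n j) =
        1 / (n : ℝ) * ∑ j ∈ Finset.range n,
          1 / (n : ℝ) * (g (i / n) * g (j / n) * min (i / n : ℝ) (j / n)) := by
      intro i hi
      rw [Finset.mul_sum]
      refine Finset.sum_congr rfl fun j hj => ?_
      simp only [hw, ht, Finset.mem_range.1 hi, Finset.mem_range.1 hj, if_true]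
      ring
    have e2 : ∀ i ∈ Finset.range n, w n i * w n n * min (t n i) (t n n) =
        r * (1 / (n : ℝ) * (min s (i / n) * g (i / n))) := by
      intro i hi
      simp only [hw, ht, Finset.mem_range.1 hi, if_true, lt_irrefl, if_false, min_comm s]
      ring
    have e3 : ∀ i ∈ Finset.range n, w n n * w n i * min (t n n) (t n i) =
        r * (1 / (n : ℝ) * (min s (i / n) * g (i / n))) := by
      intro i hi
      simp only [hw, ht, Finset.mem_range.1 hi, if_true, lt_irrefl, if_false]
      ring
    rw [Finset.sum_congr rfl e1, Finset.sum_congr rfl e2, Finset.sum_congr rfl e3]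
    simp only [← Finset.mul_sum]
    simp only [hw, ht, lt_irrefl, if_false, min_self]
    ring
  have hkey : ∀ n, n ≠ 0 → 0 ≤ v n ∧ P.map (X n) = gaussianReal 0 (v n).toNNReal := by
    intro n hn
    rw [hXeq n hn, hveq n hn]
    exact hB.map_sum (w n) (t n) (htmem n) (n + 1)
  have hXm : ∀ n, n ≠ 0 → Measurable (X n) := by
    intro n hn
    rw [hXeq n hn]
    exact Finset.measurable_sum _ fun i _ => (hB.meas _).const_mul _
  have hXlim : ∀ ω, Tendsto (fun n => X n ω) atTop (𝓝 (linFun B g r s ω)) := fun ω =>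
    (tendsto_integral_comp_gridPoint (hg.mul (hB.path ω))).add tendsto_const_nhds
  have hvlim : Tendsto v atTop (𝓝 (linVar g r s)) := by
    unfold linVar
    rw [scalarProd_covOp]
    refine (Tendsto.add ?_ (Tendsto.const_mul _ ?_)).add tendsto_const_nhds
    · exact tendsto_double_integral_comp_gridPoint (G := fun x y => g x * g y * min x y)
        (by fun_prop)
    · exact tendsto_integral_comp_gridPoint (f := fun x => min s x * g x) (by fun_prop)
  -- The shift discards `n = 0`, where the grid degenerates.
  exact map_eq_gaussianReal_of_tendsto (X := fun n => X (n + 1)) (v := fun n => v (n + 1))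
    (fun n => hXm _ n.succ_ne_zero) (fun ω => (hXlim ω).comp (tendsto_add_atTop_nat 1))
    (fun n => (hkey _ n.succ_ne_zero).1) (fun n => (hkey _ n.succ_ne_zero).2)
    (hvlim.comp (tendsto_add_atTop_nat 1))

end LinearFunctionals

/-! ### Gaussian pairs and regression. -/

section GaussianPairs

variable {Ω : Type*} [MeasurableSpace Ω] {Q : Measure Ω}

lemma integral_of_map_eq_gaussianReal {X : Ω → ℝ} (hX : Measurable X) {m : ℝ} {v : ℝ≥0}
    (h : Q.map X = gaussianReal m v) : ∫ ω, X ω ∂Q = m := by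
  have := integral_map (μ := Q) hX.aemeasurable (f := fun x : ℝ => x) (by fun_prop)
  rw [← this, h, integral_id_gaussianReal]

lemma variance_of_map_eq_gaussianReal {X : Ω → ℝ} (hX : Measurable X) {m : ℝ} {v : ℝ≥0}
    (h : Q.map X = gaussianReal m v) : Var[X; Q] = v := by
  have := variance_map (μ := Q) (X := fun x : ℝ => x) (Y := X) (by fun_prop) hX.aemeasurable
  rw [h, variance_fun_id_gaussianReal] at this
  exact this.symm

lemma memLp_of_map_eq_gaussianReal {X : Ω → ℝ} (hX : Measurable X) {m : ℝ} {v : ℝ≥0}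
    (h : Q.map X = gaussianReal m v) {p : ℝ≥0∞} (hp : p ≠ ∞) : MemLp X p Q := by
  have h1 : MemLp id p (Q.map X) := by
    rw [h]; exact memLp_id_gaussianReal' p hp
  exact (memLp_map_measure_iff (by fun_prop) hX.aemeasurable).1 h1

lemma integral_sq_of_map_eq_gaussianReal [IsProbabilityMeasure Q] {X : Ω → ℝ} (hX : Measurable X)
    {m : ℝ} {v : ℝ≥0} (h : Q.map X = gaussianReal m v) : ∫ ω, X ω ^ 2 ∂Q = v + m ^ 2 := by
  have h1 := variance_eq_sub (memLp_of_map_eq_gaussianReal hX h (p := 2) (by simp))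
  rw [variance_of_map_eq_gaussianReal hX h, integral_of_map_eq_gaussianReal hX h] at h1
  simp only [Pi.pow_apply] at h1
  linarith

lemma integrable_exp_of_map_eq_gaussianReal {X : Ω → ℝ} (hX : Measurable X) {m : ℝ} {v : ℝ≥0}
    (h : Q.map X = gaussianReal m v) :
    Integrable (fun ω => Real.exp (X ω)) Q ∧ ∫ ω, Real.exp (X ω) ∂Q = Real.exp (m + v / 2) := by
  constructor
  · have h1 : Integrable (fun x => Real.exp x) (Q.map X) := by
      rw [h]; simpa using integrable_exp_mul_gaussianReal (μ := m) (v := v) 1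
    exact (integrable_map_measure (by fun_prop) hX.aemeasurable).1 h1
  · simpa [mgf] using mgf_gaussianReal h 1

/-- If all linear combinations of `D` and `Z` are Gaussian, then conditioning on `Z` gives
`E[1_A(Z) (D² - V)]` in terms of the law of `Z`. -/
lemma integral_indicator_mul_sq_sub [IsProbabilityMeasure Q] {D Z : Ω → ℝ} (hD : Measurable D)
    (hZ : Measurable Z) {κ K V C s : ℝ} (hs : 0 < s)
    (hpos : ∀ α β, 0 ≤ α ^ 2 * V + 2 * α * β * C + β ^ 2 * s)
    (hlaw : ∀ α β, Q.map (fun ω => α * D ω + β * Z ω) =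
      gaussianReal (α * κ + β * K) (α ^ 2 * V + 2 * α * β * C + β ^ 2 * s).toNNReal)
    {A : Set ℝ} (hA : MeasurableSet A) :
    ∫ ω, A.indicator 1 (Z ω) * (D ω ^ 2 - V) ∂Q =
      ∫ z in A, gaussianPDFReal K s.toNNReal z *
        ((κ + C / s * (z - K)) ^ 2 - (C / s) ^ 2 * s) := by
  -- The regression coefficient of `D` on `Z`: it makes `W = D - c Z` uncorrelated with `Z`, hence
  -- independent of it.
  set c := C / s with hc
  have hcs : c * s = C := by rw [hc]; field_simp
  set W : Ω → ℝ := fun ω => D ω - c * Z ω with hW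
  have hWm : Measurable W := hD.sub (hZ.const_mul c)
  have hWlaw : Q.map W = gaussianReal (κ - c * K) (V - c ^ 2 * s).toNNReal := by
    convert hlaw 1 (-c) using 2
    · ext ω; simp [hW]; ring
    · ring
    · congr 1; rw [← hcs]; ring
  have hWpos : 0 ≤ V - c ^ 2 * s := by
    have := hpos 1 (-c)
    rw [← hcs] at this
    linarith
  have hZlaw : Q.map Z = gaussianReal K s.toNNReal := by
    convert hlaw 0 1 using 2
    · ext ω; simp
    · ring
    · congr 1; ring
  have hWZlaw : Q.map (W + Z) = gaussianReal (κ + (1 - c) * K)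
      (V + 2 * (1 - c) * C + (1 - c) ^ 2 * s).toNNReal := by
    convert hlaw 1 (1 - c) using 2
    · ext ω; simp [hW]; ring
    · ring
    · congr 1; ring
  have hWZpos : 0 ≤ V + 2 * (1 - c) * C + (1 - c) ^ 2 * s := by
    have := hpos 1 (1 - c)
    linarith
  have hWL : MemLp W 2 Q := memLp_of_map_eq_gaussianReal hWm hWlaw (by simp)
  have hZL : MemLp Z 2 Q := memLp_of_map_eq_gaussianReal hZ hZlaw (by simp)
  -- The hypotheses only give laws of linear combinations, so the covariance is read off from the
  -- variances of `W`, `Z` and `W + Z`.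
  have hcov : cov[W, Z; Q] = 0 := by
    have h1 := variance_add hWL hZL
    rw [variance_of_map_eq_gaussianReal hWm hWlaw, variance_of_map_eq_gaussianReal hZ hZlaw,
      variance_of_map_eq_gaussianReal (hWm.add hZ) hWZlaw, Real.coe_toNNReal _ hWpos,
      Real.coe_toNNReal _ hWZpos, Real.coe_toNNReal _ hs.le, ← hcs] at h1
    nlinarith
  have hG : HasGaussianLaw (fun ω => (W ω, Z ω)) Q := by
    refine ⟨isGaussian_of_map_eq_gaussianReal fun L => ?_⟩
    have h1 : ⇑L ∘ (fun ω => (W ω, Z ω)) =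
        fun ω => L (1, 0) * D ω + (L (0, 1) - c * L (1, 0)) * Z ω := by
      funext ω
      have : (W ω, Z ω) = W ω • ((1, 0) : ℝ × ℝ) + Z ω • ((0, 1) : ℝ × ℝ) := by simp
      simp only [Function.comp_apply]
      rw [this, map_add, map_smul, map_smul]
      simp only [hW, smul_eq_mul]
      ring
    have h2 := hlaw (L (1, 0)) (L (0, 1) - c * L (1, 0))
    rw [← h1, ← Measure.map_map L.continuous.measurable (hWm.prodMk hZ)] at h2
    exact ⟨_, _, h2⟩
  have hind : IndepFun W Z Q := hG.indepFun_of_covariance_eq_zero hcov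
  have h1A : Measurable (A.indicator (1 : ℝ → ℝ)) := measurable_one.indicator hA
  have hbd : ∀ z, ‖A.indicator (1 : ℝ → ℝ) z‖ ≤ 1 := fun z => by
    by_cases h : z ∈ A <;> simp [h]
  have hEW := integral_of_map_eq_gaussianReal hWm hWlaw
  have hEW2 := integral_sq_of_map_eq_gaussianReal hWm hWlaw
  rw [Real.coe_toNNReal _ hWpos] at hEW2
  have hZ1 := hZL.integrable one_le_two
  have hZ2 : Integrable (fun ω => Z ω ^ 2) Q := hZL.integrable_sq
  have hW2 : Integrable (fun ω => W ω ^ 2) Q := hWL.integrable_sq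
  have hWZ : Integrable (fun ω => W ω * Z ω) Q := hWL.integrable_mul hZL
  have hb : ∀ {f : Ω → ℝ}, Integrable f Q → Integrable (fun ω => A.indicator 1 (Z ω) * f ω) Q :=
    fun hf => hf.bdd_mul (c := 1) (h1A.comp hZ).aestronglyMeasurable
      (Eventually.of_forall fun ω => hbd _)
  have e1 : ∫ ω, A.indicator 1 (Z ω) * W ω ^ 2 ∂Q =
      (∫ ω, A.indicator 1 (Z ω) ∂Q) * (V - c ^ 2 * s + (κ - c * K) ^ 2) := by
    rw [← hEW2]
    exact hind.symm.integral_fun_comp_mul_comp (f := A.indicator (1 : ℝ → ℝ)) (g := fun w => w ^ 2)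
      hZ.aemeasurable hWm.aemeasurable h1A.aestronglyMeasurable (by fun_prop)
  have e2 : ∫ ω, (A.indicator 1 (Z ω) * Z ω) * W ω ∂Q =
      (∫ ω, A.indicator 1 (Z ω) * Z ω ∂Q) * (κ - c * K) := by
    rw [← hEW]
    exact hind.symm.integral_fun_comp_mul_comp (f := fun z => A.indicator (1 : ℝ → ℝ) z * z)
      (g := fun w => w) hZ.aemeasurable hWm.aemeasurable
      (h1A.mul measurable_id).aestronglyMeasurable (by fun_prop)
  have i0 : Integrable (fun ω => A.indicator (1 : ℝ → ℝ) (Z ω)) Q := by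
    simpa using hb (integrable_const (1 : ℝ))
  -- Expand `D = W + c Z` and use independence. As `E W² = V - c² s + (κ - c K)²`, the constant `V`
  -- drops out.
  have lhs : ∫ ω, A.indicator 1 (Z ω) * (D ω ^ 2 - V) ∂Q =
      ∫ ω, A.indicator 1 (Z ω) * ((κ + c * (Z ω - K)) ^ 2 - c ^ 2 * s) ∂Q := by
    have l1 : ∀ ω, A.indicator 1 (Z ω) * (D ω ^ 2 - V) = A.indicator 1 (Z ω) * W ω ^ 2 +
        (2 * c) * (A.indicator 1 (Z ω) * Z ω * W ω) + c ^ 2 * (A.indicator 1 (Z ω) * Z ω ^ 2) -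
        V * A.indicator 1 (Z ω) := fun ω => by simp only [hW]; ring
    have l2 : ∀ ω, A.indicator 1 (Z ω) * ((κ + c * (Z ω - K)) ^ 2 - c ^ 2 * s) =
        ((κ - c * K) ^ 2 - c ^ 2 * s) * A.indicator 1 (Z ω) +
        (2 * c * (κ - c * K)) * (A.indicator 1 (Z ω) * Z ω) +
        c ^ 2 * (A.indicator 1 (Z ω) * Z ω ^ 2) := fun ω => by ring
    have i1 := hb hW2
    have i2 : Integrable (fun ω => A.indicator 1 (Z ω) * Z ω * W ω) Q := by
      refine (hb hWZ).congr (Eventually.of_forall fun ω => ?_)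
      simp only; ring
    simp_rw [l1, l2]
    rw [integral_sub ((i1.fun_add (i2.const_mul _)).fun_add ((hb hZ2).const_mul _)) (i0.const_mul _),
      integral_add (i1.fun_add (i2.const_mul _)) ((hb hZ2).const_mul _),
      integral_add i1 (i2.const_mul _),
      integral_add ((i0.const_mul _).fun_add ((hb hZ1).const_mul _)) ((hb hZ2).const_mul _),
      integral_add (i0.const_mul _) ((hb hZ1).const_mul _)]
    simp only [integral_const_mul]
    rw [e1, e2]
    ring
  rw [lhs]
  have hq : ∫ ω, A.indicator 1 (Z ω) * ((κ + c * (Z ω - K)) ^ 2 - c ^ 2 * s) ∂Q =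
      ∫ z, A.indicator 1 z * ((κ + c * (z - K)) ^ 2 - c ^ 2 * s) ∂(Q.map Z) := by
    rw [integral_map hZ.aemeasurable]
    exact (h1A.mul (by fun_prop)).aestronglyMeasurable
  rw [hq, hZlaw, integral_gaussianReal_eq_integral_smul (by simpa using hs),
    ← integral_indicator hA]
  congr 1
  funext z
  by_cases h : z ∈ A <;> simp [h]

end GaussianPairs

/-! ### Bilinear algebra of the covariance operator. -/

section Covariances

lemma intervalIntegral_swap_of_continuous {F : ℝ → ℝ → ℝ} (hF : Continuous (Function.uncurry F))
    (a b c d : ℝ) :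
    ∫ x in a..b, ∫ y in c..d, F x y = ∫ y in c..d, ∫ x in a..b, F x y :=
  intervalIntegral_intervalIntegral_swap <|
    (hF.continuousOn.integrableOn_compact (isCompact_uIcc.prod isCompact_uIcc)).mono_set
      (prod_mono uIoc_subset_uIcc uIoc_subset_uIcc)

lemma continuous_covOp {k : ℝ → ℝ} (hk : Continuous k) : Continuous (covOp k) := by
  unfold covOp
  exact intervalIntegral.continuous_parametric_intervalIntegral_of_continuous' (by fun_prop) 0 1

lemma covOp_add_mul {f g : ℝ → ℝ} (hf : Continuous f) (hg : Continuous g) (c θ : ℝ) :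
    covOp (fun σ => f σ + c * g σ) θ = covOp f θ + c * covOp g θ := by
  unfold covOp
  rw [← intervalIntegral.integral_const_mul, ← intervalIntegral.integral_add]
  · exact intervalIntegral.integral_congr fun σ _ => by ring
  all_goals exact Continuous.intervalIntegrable (by fun_prop) _ _

lemma scalarProd_covOp_comm {f g : ℝ → ℝ} (hf : Continuous f) (hg : Continuous g) :
    scalarProd (covOp f) g = scalarProd (covOp g) f := by
  rw [scalarProd_covOp, scalarProd_covOp, intervalIntegral_swap_of_continuous (by fun_prop)]
  refine intervalIntegral.integral_congr fun x _ => intervalIntegral.integral_congr fun y _ => ?_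
  simp only [min_comm x y]; ring

lemma scalarProd_add_mul_right {f g u : ℝ → ℝ} (hf : Continuous f) (hg : Continuous g)
    (hu : Continuous u) (c : ℝ) :
    scalarProd u (fun σ => f σ + c * g σ) = scalarProd u f + c * scalarProd u g := by
  unfold scalarProd
  rw [← intervalIntegral.integral_const_mul, ← intervalIntegral.integral_add]
  · exact intervalIntegral.integral_congr fun σ _ => by ring
  all_goals exact Continuous.intervalIntegrable (by fun_prop) _ _

/-- Used with `f = k` and `g = m`: the cross terms containing `covOp f` become the Cameron–Martin
shift. -/
lemma linVar_add_mul {f g : ℝ → ℝ} (hf : Continuous f) (hg : Continuous g) (c r s : ℝ) :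
    linVar (fun σ => f σ + c * g σ) r s = scalarProd (covOp f) f +
      2 * c * scalarProd (covOp f) g + c ^ 2 * scalarProd (covOp g) g +
      2 * r * (covOp f s + c * covOp g s) + r ^ 2 * s := by
  unfold linVar
  have h : Continuous fun σ => f σ + c * g σ := by fun_prop
  rw [scalarProd_add_mul_right hf hg (continuous_covOp h), scalarProd_covOp_comm h hf,
    scalarProd_covOp_comm h hg, scalarProd_add_mul_right hf hg (continuous_covOp hf),
    scalarProd_add_mul_right hf hg (continuous_covOp hg), covOp_add_mul hf hg,
    scalarProd_covOp_comm hg hf]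
  ring

end Covariances

/-! ### Exponential tilting. -/

section CameronMartin

variable {Ω : Type*} [MeasurableSpace Ω] {P : Measure Ω} {B : ℝ → Ω → ℝ}

lemma scalarProd_comm (f g : ℝ → ℝ) : scalarProd f g = scalarProd g f := by
  unfold scalarProd
  exact intervalIntegral.integral_congr fun x _ => mul_comm _ _

lemma linFun_eq {Ω : Type*} (B : ℝ → Ω → ℝ) (g : ℝ → ℝ) (r s : ℝ) (ω : Ω) :
    linFun B g r s ω = scalarProd (fun σ => B σ ω) g + r * B s ω := by
  rw [scalarProd_comm]; rfl

lemma IsRegularBrownian.linFun_add_mul (hB : IsRegularBrownian B P) {f g : ℝ → ℝ}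
    (hf : Continuous f) (hg : Continuous g) (c r s : ℝ) (ω : Ω) :
    linFun B (fun σ => f σ + c * g σ) r s ω =
      scalarProd (fun σ => B σ ω) f + c * scalarProd (fun σ => B σ ω) g + r * B s ω := by
  rw [linFun_eq, scalarProd_add_mul_right hf hg (hB.path ω)]

lemma IsRegularBrownian.measurable_scalarProd (hB : IsRegularBrownian B P) {g : ℝ → ℝ}
    (hg : Continuous g) : Measurable fun ω => scalarProd (fun σ => B σ ω) g := by
  have h : linFun B g 0 0 = fun ω => scalarProd (fun σ => B σ ω) g := by
    funext ω; simp [linFun_eq]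
  exact h ▸ hB.measurable_linFun hg 0 0

lemma linVar_zero (g : ℝ → ℝ) (s : ℝ) : linVar g 0 s = scalarProd (covOp g) g := by
  simp [linVar]

lemma IsRegularBrownian.map_scalarProd [IsProbabilityMeasure P] (hB : IsRegularBrownian B P)
    {g : ℝ → ℝ} (hg : Continuous g) : 0 ≤ scalarProd (covOp g) g ∧
    P.map (fun ω => scalarProd (fun σ => B σ ω) g) =
      gaussianReal 0 (scalarProd (covOp g) g).toNNReal := by
  have := hB.map_linFun hg 0 (s := 0) (by simp)
  rw [linVar_zero] at this
  convert this using 4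
  simp [linFun_eq]

lemma IsRegularBrownian.integral_sq_scalarProd [IsProbabilityMeasure P]
    (hB : IsRegularBrownian B P) {g : ℝ → ℝ} (hg : Continuous g) :
    ∫ ω, scalarProd (fun σ => B σ ω) g ^ 2 ∂P = scalarProd (covOp g) g := by
  obtain ⟨h0, h1⟩ := hB.map_scalarProd hg
  rw [integral_sq_of_map_eq_gaussianReal (hB.measurable_scalarProd hg) h1, Real.coe_toNNReal _ h0]
  simp

lemma IsRegularBrownian.integral_exp_linFun [IsProbabilityMeasure P] (hB : IsRegularBrownian B P)
    {g : ℝ → ℝ} (hg : Continuous g) (r : ℝ) {s : ℝ} (hs : s ∈ Icc (0 : ℝ) 1) :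
    Integrable (fun ω => Real.exp (linFun B g r s ω)) P ∧
      ∫ ω, Real.exp (linFun B g r s ω) ∂P = Real.exp (linVar g r s / 2) := by
  obtain ⟨h0, h1⟩ := hB.map_linFun hg r hs
  have := integrable_exp_of_map_eq_gaussianReal (hB.measurable_linFun hg r s) h1
  rwa [zero_add, Real.coe_toNNReal _ h0] at this

/-- Cameron–Martin: the law of `(∫ m B, B_s)` under the measure with density proportional to
`exp (∫ k B)`. -/
lemma IsRegularBrownian.map_tilted [IsProbabilityMeasure P] (hB : IsRegularBrownian B P)
    {k m : ℝ → ℝ} (hk : Continuous k) (hm : Continuous m) {s : ℝ} (hs : s ∈ Icc (0 : ℝ) 1)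
    (α β : ℝ) :
    0 ≤ α ^ 2 * scalarProd (covOp m) m + 2 * α * β * covOp m s + β ^ 2 * s ∧
    (P.tilted fun ω => scalarProd (fun σ => B σ ω) k).map
      (fun ω => α * scalarProd (fun σ => B σ ω) m + β * B s ω) =
      gaussianReal (α * scalarProd (covOp k) m + β * covOp k s)
        (α ^ 2 * scalarProd (covOp m) m + 2 * α * β * covOp m s + β ^ 2 * s).toNNReal := by
  have h0 : 0 ≤ α ^ 2 * scalarProd (covOp m) m + 2 * α * β * covOp m s + β ^ 2 * s := by
    have h1 := (hB.map_linFun (g := fun σ => 0 + α * m σ) (by fun_prop) β hs).1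
    rw [linVar_add_mul continuous_const hm] at h1
    have e1 : scalarProd (covOp fun _ => (0 : ℝ)) m = 0 := by simp [scalarProd, covOp]
    have e2 : scalarProd (covOp fun _ => (0 : ℝ)) (fun _ => (0 : ℝ)) = 0 := by simp [scalarProd]
    have e3 : covOp (fun _ => (0 : ℝ)) s = 0 := by simp [covOp]
    rw [e1, e2, e3] at h1
    linarith
  refine ⟨h0, ?_⟩
  obtain ⟨hi, he⟩ := hB.integral_exp_linFun hk 0 hs
  simp only [linFun_eq, zero_mul, add_zero, linVar_zero] at hi he
  have : IsProbabilityMeasure (P.tilted fun ω => scalarProd (fun σ => B σ ω) k) :=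
    isProbabilityMeasure_tilted hi
  refine map_eq_gaussianReal_of_mgf
    (((hB.measurable_scalarProd hm).const_mul α).add ((hB.meas s).const_mul β)).aemeasurable
    fun t => ?_
  -- The total exponent is again a linear functional of `B`, so the tilted moment generating
  -- function is a quotient of two Gaussian exponentials.
  have e : ∀ ω, ((fun ω => scalarProd (fun σ => B σ ω) k) + fun ω =>
      t * (α * scalarProd (fun σ => B σ ω) m + β * B s ω)) ω =
      linFun B (fun σ => k σ + (t * α) * m σ) (t * β) s ω := fun ω => by
    rw [hB.linFun_add_mul hk hm]
    simp only [Pi.add_apply]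
    ring
  rw [mgf, integral_exp_tilted, he]
  refine (congrArg (· / _) (integral_congr_ae
    (Eventually.of_forall fun ω => congrArg Real.exp (e ω)))).trans ?_
  rw [(hB.integral_exp_linFun (g := fun σ => k σ + (t * α) * m σ) (by fun_prop) (t * β) hs).2,
    linVar_add_mul hk hm, ← Real.exp_sub, Real.coe_toNNReal _ h0]
  congr 1
  ring

/-- The density at `z` of `E[exp (∫ k B) ((∫ m B)² - E (∫ m B)²); B_s ∈ dz]`, up to the factor
`E[exp (∫ k B)]`. -/
noncomputable def wickDensity (k m : ℝ → ℝ) (s z : ℝ) : ℝ :=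
  gaussianPDFReal (covOp k s) s.toNNReal z *
    ((scalarProd (covOp k) m + covOp m s / s * (z - covOp k s)) ^ 2 - (covOp m s / s) ^ 2 * s)

/-- The subtracted constant is the variance under `P`. Tilting changes means but not covariances, so
it is also the variance under the tilted measure, to which the regression formula applies. -/
lemma IsRegularBrownian.integral_exp_mul_indicator [IsProbabilityMeasure P]
    (hB : IsRegularBrownian B P) {k m : ℝ → ℝ} (hk : Continuous k) (hm : Continuous m) {s : ℝ}
    (hs : s ∈ Ioc (0 : ℝ) 1) {A : Set ℝ} (hA : MeasurableSet A) :
    ∫ ω, Real.exp (scalarProd (fun σ => B σ ω) k) * (A.indicator 1 (B s ω) *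
      (scalarProd (fun σ => B σ ω) m ^ 2 - ∫ ω', scalarProd (fun σ => B σ ω') m ^ 2 ∂P)) ∂P =
    Real.exp (scalarProd (covOp k) k / 2) * ∫ z in A, wickDensity k m s z := by
  have hs' : s ∈ Icc (0 : ℝ) 1 := Ioc_subset_Icc_self hs
  obtain ⟨hi, he⟩ := hB.integral_exp_linFun hk 0 hs'
  simp only [linFun_eq, zero_mul, add_zero, linVar_zero] at hi he
  have : IsProbabilityMeasure (P.tilted fun ω => scalarProd (fun σ => B σ ω) k) :=
    isProbabilityMeasure_tilted hi
  have h1 := integral_indicator_mul_sq_sub (hB.measurable_scalarProd hm) (hB.meas s) hs.1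
    (fun α β => (hB.map_tilted hk hm hs' α β).1) (fun α β => (hB.map_tilted hk hm hs' α β).2) hA
  rw [integral_tilted, he] at h1
  rw [hB.integral_sq_scalarProd hm]
  unfold wickDensity
  rw [← h1, ← integral_const_mul]
  congr 1
  funext ω
  rw [smul_eq_mul]
  field_simp

end CameronMartin

/-! ### The regularised derivative as a linear functional. -/

section Mollifiers

/-- The kernel `m` with `Ḃ_{ε,θ} = ∫_0^1 m_σ B_σ dσ`. -/
noncomputable def derivKernel (ρ : ℝ → ℝ) (ε θ σ : ℝ) : ℝ :=
  -(1 / ε ^ 2) * deriv ρ ((σ - θ) / ε)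

lemma IsMollifier.hasCompactSupport {ρ : ℝ → ℝ} (hρ : IsMollifier ρ) : HasCompactSupport ρ :=
  isCompact_Icc.of_isClosed_subset (isClosed_tsupport ρ)
    (hρ.support.trans Ioo_subset_Icc_self)

lemma IsMollifier.continuous_deriv {ρ : ℝ → ℝ} (hρ : IsMollifier ρ) : Continuous (deriv ρ) :=
  hρ.smooth.continuous_deriv (by simp)

lemma IsMollifier.hasDerivAt {ρ : ℝ → ℝ} (hρ : IsMollifier ρ) (x : ℝ) :
    HasDerivAt ρ (deriv ρ x) x :=
  ((hρ.smooth.differentiable (by simp)) x).hasDerivAt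

lemma IsMollifier.continuous {ρ : ℝ → ℝ} (hρ : IsMollifier ρ) : Continuous ρ :=
  hρ.smooth.continuous

lemma IsMollifier.exists_bound_deriv {ρ : ℝ → ℝ} (hρ : IsMollifier ρ) : ∃ C, ∀ x, |deriv ρ x| ≤ C :=
  hρ.hasCompactSupport.deriv.exists_bound_of_continuous hρ.continuous_deriv

lemma IsMollifier.continuous_derivKernel {ρ : ℝ → ℝ} (hρ : IsMollifier ρ) (ε : ℝ) :
    Continuous (Function.uncurry (derivKernel ρ ε)) := by
  have := hρ.continuous_deriv
  unfold derivKernel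
  fun_prop

lemma IsMollifier.hasDerivAt_scaled {ρ : ℝ → ℝ} (hρ : IsMollifier ρ) (ε σ θ : ℝ) :
    HasDerivAt (fun θ => scaled ρ ε (σ - θ)) (derivKernel ρ ε θ σ) θ := by
  unfold scaled derivKernel
  have h1 : HasDerivAt (fun θ : ℝ => (σ - θ) / ε) (-1 / ε) θ :=
    ((hasDerivAt_id θ).const_sub σ).div_const ε
  refine (((hρ.hasDerivAt _).comp θ h1).const_mul (1 / ε)).congr_deriv ?_
  -- At `ε = 0` division by zero makes both the function and the kernel vanish.
  by_cases h : ε = 0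
  · simp [h]
  · field_simp

/-- Differentiation under the integral, dominated through the bound on `deriv ρ`: the derivative
falls on the mollifier, never on the path. -/
lemma IsMollifier.deriv_regularize {ρ : ℝ → ℝ} (hρ : IsMollifier ρ) (ε : ℝ) {ℓ : ℝ → ℝ}
    (hℓ : Continuous ℓ) (θ : ℝ) :
    deriv (regularize ρ ε ℓ) θ = scalarProd ℓ (derivKernel ρ ε θ) := by
  obtain ⟨C, hC⟩ := hρ.exists_bound_deriv
  have hcont := hρ.continuous
  have hk := hρ.continuous_derivKernel ε
  have hd := intervalIntegral.hasDerivAt_integral_of_dominated_loc_of_deriv_le (𝕜 := ℝ)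
    (μ := volume) (a := 0) (b := 1)
    (F := fun θ σ => scaled ρ ε (σ - θ) * ℓ σ) (F' := fun θ σ => derivKernel ρ ε θ σ * ℓ σ)
    (x₀ := θ) (s := univ) (bound := fun σ => 1 / ε ^ 2 * C * |ℓ σ|) univ_mem
    (Eventually.of_forall fun x => Continuous.aestronglyMeasurable (by unfold scaled; fun_prop))
    (Continuous.intervalIntegrable (by unfold scaled; fun_prop) _ _)
    (Continuous.aestronglyMeasurable ((hk.comp (by fun_prop : Continuous fun σ => (θ, σ))).mul hℓ))
    (Eventually.of_forall fun σ _ x _ => by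
      rw [norm_mul, Real.norm_eq_abs, Real.norm_eq_abs, derivKernel, abs_mul, abs_neg,
        abs_of_nonneg (by positivity : (0 : ℝ) ≤ 1 / ε ^ 2)]
      gcongr
      exact hC _)
    (Continuous.intervalIntegrable (by fun_prop) _ _)
    (Eventually.of_forall fun σ _ x _ => (hρ.hasDerivAt_scaled ε σ x).mul_const _)
  rw [scalarProd_comm]
  exact hd.2.deriv

end Mollifiers

/-! ### Second moments of occupation times. -/

section OccupationMoments

/-- The density is at most `1 / √(2πv)`, hence at most `1 / √v`. -/
lemma gaussianReal_Ioc_le (m : ℝ) {v : ℝ} (hv : 0 < v) (x y : ℝ) :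
    gaussianReal m v.toNNReal (Ioc x y) ≤ ENNReal.ofReal ((y - x) / √v) := by
  have hv' : v.toNNReal ≠ 0 := by simpa using hv
  rw [gaussianReal_apply _ hv']
  have hb : ∀ z, gaussianPDF m v.toNNReal z ≤ ENNReal.ofReal (1 / √v) := by
    intro z
    rw [gaussianPDF_def]
    refine ENNReal.ofReal_le_ofReal ?_
    simp only [gaussianPDFReal_def, Real.coe_toNNReal _ hv.le, one_div]
    have h1 : (√(2 * Real.pi * v))⁻¹ ≤ (√v)⁻¹ := by
      gcongr
      nlinarith [Real.pi_gt_three]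
    have h2 : Real.exp (-(z - m) ^ 2 / (2 * v)) ≤ 1 := by
      rw [Real.exp_le_one_iff]
      exact div_nonpos_of_nonpos_of_nonneg (by nlinarith [sq_nonneg (z - m)]) (by positivity)
    calc _ ≤ (√v)⁻¹ * 1 := mul_le_mul h1 h2 (Real.exp_nonneg _) (by positivity)
      _ = _ := mul_one _
  calc _ ≤ ∫⁻ _ in Ioc x y, ENNReal.ofReal (1 / √v) := lintegral_mono hb
    _ = ENNReal.ofReal (1 / √v) * ENNReal.ofReal (y - x) := by simp
    _ = _ := by
      rw [← ENNReal.ofReal_mul (by positivity)]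
      congr 1; ring

variable {Ω : Type*} [MeasurableSpace Ω] {P : Measure Ω} {B : ℝ → Ω → ℝ}

lemma IsRegularBrownian.map_eval [IsProbabilityMeasure P] (hB : IsRegularBrownian B P) {s : ℝ}
    (hs : s ∈ Icc (0 : ℝ) 1) : P.map (B s) = gaussianReal 0 s.toNNReal := by
  have h := (hB.map_linFun (g := fun _ => 0) continuous_const 1 hs).2
  have e1 : linFun B (fun _ => 0) 1 s = B s := by funext ω; simp [linFun]
  have e2 : linVar (fun _ => 0) 1 s = s := by simp [linVar, covOp, scalarProd]
  rwa [e1, e2] at h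

lemma IsRegularBrownian.map_increment [IsProbabilityMeasure P] (hB : IsRegularBrownian B P)
    {s t : ℝ} (hs : 0 ≤ s) (hst : s < t) (ht : t ≤ 1) :
    IndepFun (B s) (fun ω => B t ω - B s ω) P ∧
      P.map (fun ω => B t ω - B s ω) = gaussianReal 0 (t - s).toNNReal := by
  have hs' : s ∈ Icc (0 : ℝ) 1 := ⟨hs, hst.le.trans ht⟩
  have ht' : t ∈ Icc (0 : ℝ) 1 := ⟨hs.trans hst.le, ht⟩
  have hp : HasGaussianLaw (fun ω => (B s ω, B t ω)) P :=
    hB.gaussian.hasGaussianLaw_prodMk (s := ⟨s, hs'⟩) (t := ⟨t, ht'⟩)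
  have hL := hp.map_fun ((ContinuousLinearMap.fst ℝ ℝ ℝ).prod
    (ContinuousLinearMap.snd ℝ ℝ ℝ - ContinuousLinearMap.fst ℝ ℝ ℝ))
  have hL' : HasGaussianLaw (fun ω => (B s ω, B t ω - B s ω)) P := hL
  have ms := hp.fst.memLp_two
  have mt := hp.snd.memLp_two
  have vs : Var[B s; P] = s := by
    rw [← covariance_self (hB.meas s).aemeasurable, hB.cov _ hs' _ hs', min_self]
  have vt : Var[B t; P] = t := by
    rw [← covariance_self (hB.meas t).aemeasurable, hB.cov _ ht' _ ht', min_self]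
  refine ⟨hL'.indepFun_of_covariance_eq_zero ?_, ?_⟩
  · rw [covariance_fun_sub_right ms mt ms, covariance_self (hB.meas s).aemeasurable, vs,
      hB.cov _ hs' _ ht', min_eq_left hst.le, sub_self]
  · rw [hL'.snd.map_eq_gaussianReal, integral_sub (mt.integrable one_le_two)
      (ms.integrable one_le_two), hB.mean _ hs', hB.mean _ ht', variance_fun_sub mt ms, vs, vt,
      hB.cov _ ht' _ hs', min_eq_right hst.le]
    congr 2
    · ring
    · ring

/-- If both values lie in the window, the increment lies in `(-2δ, 2δ]`. It is independent of `B s`,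
so the factors `2δ / √η` and `4δ / √(t - s)` multiply. -/
lemma IsRegularBrownian.measure_pair_le [IsProbabilityMeasure P] (hB : IsRegularBrownian B P)
    {η s t δ : ℝ} (a : ℝ) (hη : 0 < η) (hδ : 0 < δ) (hs : η ≤ s) (hst : s < t) (ht : t ≤ 1) :
    P (B s ⁻¹' Ioc (a - δ) (a + δ) ∩ B t ⁻¹' Ioc (a - δ) (a + δ)) ≤
      ENNReal.ofReal (8 * δ ^ 2 / √η) * ENNReal.ofReal (1 / √|t - s|) := by
  have hs0 : 0 < s := hη.trans_le hs
  obtain ⟨hind, hlaw⟩ := hB.map_increment hs0.le hst ht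
  have hsub : B s ⁻¹' Ioc (a - δ) (a + δ) ∩ B t ⁻¹' Ioc (a - δ) (a + δ) ⊆
      B s ⁻¹' Ioc (a - δ) (a + δ) ∩ (fun ω => B t ω - B s ω) ⁻¹' Ioc (-(2 * δ)) (2 * δ) := by
    rintro ω ⟨⟨h1, h2⟩, h3, h4⟩
    refine ⟨⟨h1, h2⟩, ?_, ?_⟩ <;> simp only <;> linarith
  refine (measure_mono hsub).trans ?_
  rw [hind.measure_inter_preimage_eq_mul _ _ measurableSet_Ioc measurableSet_Ioc,
    ← Measure.map_apply (hB.meas s) measurableSet_Ioc,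
    ← Measure.map_apply (show Measurable fun ω => B t ω - B s ω from (hB.meas t).sub (hB.meas s))
      measurableSet_Ioc, hlaw,
    hB.map_eval ⟨hs0.le, hst.le.trans ht⟩]
  refine (mul_le_mul' (gaussianReal_Ioc_le 0 hs0 _ _)
    (gaussianReal_Ioc_le 0 (sub_pos.2 hst) _ _)).trans ?_
  rw [← ENNReal.ofReal_mul' (div_nonneg (by linarith) (Real.sqrt_nonneg _)), ← ENNReal.ofReal_mul' (by positivity)]
  refine ENNReal.ofReal_le_ofReal ?_
  rw [abs_of_pos (sub_pos.2 hst)]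
  have h1 : (a + δ - (a - δ)) / √s ≤ 2 * δ / √η := by
    have : a + δ - (a - δ) = 2 * δ := by ring
    rw [this]
    gcongr
  have h2 : (2 * δ - -(2 * δ)) / √(t - s) = 4 * δ * (1 / √(t - s)) := by ring
  rw [h2]
  calc _ ≤ 2 * δ / √η * (4 * δ * (1 / √(t - s))) := by gcongr
    _ = _ := by ring

lemma lintegral_inv_sqrt_lt_top :
    ∫⁻ u in Icc (-1 : ℝ) 1, ENNReal.ofReal (1 / √|u|) < ∞ := by
  have h1 : IntegrableOn (fun u : ℝ => u ^ (-(1 / 2) : ℝ)) (Icc (-1) 1) := by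
    have := intervalIntegral.intervalIntegrable_rpow' (a := -1) (b := 1) (r := -(1 / 2)) (by norm_num)
    rwa [intervalIntegrable_iff_integrableOn_Icc_of_le (by norm_num)] at this
  have h2 : IntegrableOn (fun u : ℝ => (-u) ^ (-(1 / 2) : ℝ)) (Icc (-1) 1) := by
    have := h1.comp_neg
    simpa using this
  have h3 := h1.add h2
  refine lt_of_le_of_lt (lintegral_mono fun u => ?_) h3.lintegral_lt_top
  refine ENNReal.ofReal_le_ofReal ?_
  have key : ∀ x : ℝ, 0 ≤ x → 1 / √x = x ^ (-(1 / 2) : ℝ) := fun x hx => by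
    rw [Real.rpow_neg hx, Real.sqrt_eq_rpow, one_div]
  -- The real power of a negative base carries the factor `cos (π r)`, zero at `r = -1/2`; hence for
  -- `u ≠ 0` exactly one of the two summands survives.
  have hneg : ∀ x : ℝ, x < 0 → x ^ (-(1 / 2) : ℝ) = 0 := fun x hx => by
    rw [Real.rpow_def_of_neg hx]
    have : (-(1 / 2) : ℝ) * Real.pi = -(Real.pi / 2) := by ring
    rw [this, Real.cos_neg, Real.cos_pi_div_two, mul_zero]
  rcases lt_trichotomy u 0 with h | h | h
  · simp only [Pi.add_apply]
    rw [hneg u h, zero_add, abs_of_neg h, key _ (by linarith)]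
  · subst h; simp only [abs_zero, Real.sqrt_zero, div_zero, Pi.add_apply]; positivity
  · simp only [Pi.add_apply]
    rw [hneg (-u) (by linarith), add_zero, abs_of_pos h, key _ h.le]

lemma lintegral_inv_sqrt_sub_le {s : ℝ} (hs : s ∈ Icc (0 : ℝ) 1) {η : ℝ} (hη : 0 ≤ η) :
    ∫⁻ t in Icc η 1, ENNReal.ofReal (1 / √|t - s|) ≤
      ∫⁻ u in Icc (-1 : ℝ) 1, ENNReal.ofReal (1 / √|u|) := by
  rw [← lintegral_indicator measurableSet_Icc, ← lintegral_indicator measurableSet_Icc,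
    ← lintegral_sub_right_eq_self ((Icc (-1 : ℝ) 1).indicator _) s]
  refine lintegral_mono fun t => ?_
  by_cases ht : t ∈ Icc η 1
  · have h1 : t - s ∈ Icc (-1 : ℝ) 1 :=
      ⟨by linarith [ht.1, hs.2], by linarith [ht.2, hs.1]⟩
    rw [indicator_of_mem ht, indicator_of_mem h1]
  · rw [indicator_of_notMem ht]
    exact zero_le

/-- Write the square as a double time integral and exchange it with the expectation: the pair bound
contributes `δ²` and the integrable singularity `|t - s|^(-1/2)`. Staying above `η` avoids the
degenerate law at time `0`. -/
lemma IsRegularBrownian.lintegral_sq_occupation_le [IsProbabilityMeasure P]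
    (hB : IsRegularBrownian B P) {η δ : ℝ} (a : ℝ) (hη : 0 < η) (hδ : 0 < δ) :
    ∫⁻ ω, (∫⁻ s in Icc η 1, (B s ⁻¹' Ioc (a - δ) (a + δ)).indicator 1 ω) ^ 2 ∂P ≤
      ENNReal.ofReal (8 * δ ^ 2 / √η) *
        ∫⁻ u in Icc (-1 : ℝ) 1, ENNReal.ofReal (1 / √|u|) := by
  set A := Ioc (a - δ) (a + δ) with hA
  set f : ℝ → Ω → ℝ≥0∞ := fun s ω => (B s ⁻¹' A).indicator 1 ω with hf
  have hfm : Measurable (Function.uncurry f) := by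
    have h1 : MeasurableSet {p : ℝ × Ω | B p.1 p.2 ∈ A} :=
      hB.measurable_uncurry measurableSet_Ioc
    have h2 : Function.uncurry f = {p : ℝ × Ω | B p.1 p.2 ∈ A}.indicator 1 := by
      funext p; rfl
    rw [h2]
    exact measurable_one.indicator h1
  have e1 : ∀ ω, (∫⁻ s in Icc η 1, f s ω) ^ 2 = ∫⁻ s in Icc η 1, ∫⁻ t in Icc η 1, f s ω * f t ω := by
    intro ω
    rw [sq, ← lintegral_mul_const _ (show Measurable fun s => f s ω from hfm.comp measurable_prodMk_right)]
    refine lintegral_congr fun s => ?_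
    rw [← lintegral_const_mul _ (show Measurable fun s => f s ω from hfm.comp measurable_prodMk_right)]
  have e2 : ∀ s ∈ Icc η 1, ∀ t ∈ Icc η 1, s ≠ t → ∫⁻ ω, f s ω * f t ω ∂P ≤
      ENNReal.ofReal (8 * δ ^ 2 / √η) * ENNReal.ofReal (1 / √|t - s|) := by
    intro s hs t ht hst
    have h1 : ∀ ω, f s ω * f t ω = (B s ⁻¹' A ∩ B t ⁻¹' A).indicator 1 ω := fun ω => by
      rw [inter_indicator_one]; rfl
    simp_rw [h1]
    rw [lintegral_indicator_one ((hB.meas s measurableSet_Ioc).inter (hB.meas t measurableSet_Ioc))]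
    rcases lt_or_gt_of_ne hst with h | h
    · exact hB.measure_pair_le a hη hδ hs.1 h ht.2
    · rw [inter_comm, abs_sub_comm]
      exact hB.measure_pair_le a hη hδ ht.1 h hs.2
  have e3 : ∀ s ∈ Icc η 1, ∫⁻ ω, (∫⁻ t in Icc η 1, f s ω * f t ω) ∂P ≤
      ENNReal.ofReal (8 * δ ^ 2 / √η) *
        ∫⁻ u in Icc (-1 : ℝ) 1, ENNReal.ofReal (1 / √|u|) := by
    intro s hs
    rw [lintegral_lintegral_swap]
    swap
    · exact ((hfm.comp (measurable_const.prodMk measurable_fst)).mul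
        (hfm.comp measurable_swap)).aemeasurable
    calc _ ≤ ∫⁻ t in Icc η 1, ENNReal.ofReal (8 * δ ^ 2 / √η) * ENNReal.ofReal (1 / √|t - s|) := by
          refine lintegral_mono_ae ?_
          have hne : ∀ᵐ t ∂(volume.restrict (Icc η 1)), t ≠ s :=
            ae_restrict_of_ae (by simp [ae_iff])
          filter_upwards [hne, ae_restrict_mem measurableSet_Icc] with t h1 h2
          exact e2 s hs t h2 h1.symm
      _ ≤ _ := by
          rw [lintegral_const_mul _ (by fun_prop)]
          refine mul_le_mul_right ?_ _
          exact lintegral_inv_sqrt_sub_le ⟨hη.le.trans hs.1, hs.2⟩ hη.le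
  calc _ = ∫⁻ ω, (∫⁻ s in Icc η 1, ∫⁻ t in Icc η 1, f s ω * f t ω) ∂P := lintegral_congr e1
    _ = ∫⁻ s in Icc η 1, ∫⁻ ω, (∫⁻ t in Icc η 1, f s ω * f t ω) ∂P := by
        refine lintegral_lintegral_swap (Measurable.aemeasurable ?_)
        refine Measurable.lintegral_prod_right' (f := fun q : (Ω × ℝ) × ℝ => f q.1.2 q.1.1 * f q.2 q.1.1) ?_
        exact (hfm.comp (measurable_fst.snd.prodMk measurable_fst.fst)).mul
          (hfm.comp (measurable_snd.prodMk measurable_fst.fst))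
    _ ≤ ∫⁻ s in Icc η 1, ENNReal.ofReal (8 * δ ^ 2 / √η) *
        ∫⁻ u in Icc (-1 : ℝ) 1, ENNReal.ofReal (1 / √|u|) := by
        refine lintegral_mono_ae ?_
        filter_upwards [ae_restrict_mem measurableSet_Icc] with s hs using e3 s hs
    _ = ENNReal.ofReal (1 - η) * (ENNReal.ofReal (8 * δ ^ 2 / √η) *
        ∫⁻ u in Icc (-1 : ℝ) 1, ENNReal.ofReal (1 / √|u|)) := by
        rw [lintegral_const, mul_comm]; simp
    _ ≤ _ := by
        refine mul_le_of_le_one_left zero_le (ENNReal.ofReal_le_one.2 ?_)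
        linarith

end OccupationMoments

/-! ### Uniform integrability. -/

section Vitali

variable {Ω : Type*} [MeasurableSpace Ω] {P : Measure Ω}

/-- A convergence theorem for products of a square integrable variable and an `L²`-bounded
sequence. -/
lemma tendsto_integral_of_le_mul [IsFiniteMeasure P] {Z : ℕ → Ω → ℝ} {Y G : Ω → ℝ} {ℓ : ℕ → Ω → ℝ}
    {C : ℝ≥0} (hZ : ∀ n, AEStronglyMeasurable (Z n) P)
    (hlim : ∀ᵐ ω ∂P, Tendsto (fun n => Z n ω) atTop (𝓝 (Y ω))) (hG : MemLp G 2 P)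
    (hℓ : ∀ n, AEStronglyMeasurable (ℓ n) P) (hC : ∀ n, eLpNorm (ℓ n) 2 P ≤ C)
    (hb : ∀ n ω, |Z n ω| ≤ G ω * ℓ n ω) :
    Integrable Y P ∧ Tendsto (fun n => ∫ ω, Z n ω ∂P) atTop (𝓝 (∫ ω, Y ω ∂P)) := by
  -- Hölder on `A`: since `‖1_A G‖₂` is small when `P A` is, the sequence is uniformly integrable
  -- and Vitali's theorem applies.
  have key : ∀ n, ∀ A, MeasurableSet A →
      eLpNorm (A.indicator (Z n)) 1 P ≤ eLpNorm (A.indicator G) 2 P * C := by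
    intro n A hA
    calc eLpNorm (A.indicator (Z n)) 1 P ≤ eLpNorm (A.indicator G • ℓ n) 1 P := by
          refine eLpNorm_mono fun ω => ?_
          by_cases h : ω ∈ A
          · simp only [indicator_of_mem h, Pi.smul_apply', smul_eq_mul]
            exact (hb n ω).trans (le_abs_self _)
          · simp [indicator_of_notMem h]
      _ ≤ eLpNorm (A.indicator G) 2 P * eLpNorm (ℓ n) 2 P :=
          eLpNorm_smul_le_mul_eLpNorm (hℓ n) (hG.1.indicator hA)
      _ ≤ _ := mul_le_mul_right (hC n) _
  have hunif : UnifIntegrable Z 1 P := by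
    intro ε hε
    obtain ⟨δ, hδ, h⟩ := hG.eLpNorm_indicator_le one_le_two (by simp)
      (ε := ε / (C + 1)) (by positivity)
    refine ⟨δ, hδ, fun n A hA hPA => (key n A hA).trans ?_⟩
    calc _ ≤ ENNReal.ofReal (ε / (C + 1)) * ENNReal.ofReal (C + 1) := by
          refine mul_le_mul' (h A hA hPA) ?_
          rw [← ENNReal.ofReal_coe_nnreal]
          exact ENNReal.ofReal_le_ofReal (by simp)
      _ = ENNReal.ofReal ε := by
          rw [← ENNReal.ofReal_mul (by positivity)]
          congr 1
          have : (C : ℝ) + 1 ≠ 0 := by positivity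
          field_simp
  have hUI : UniformIntegrable Z 1 P := by
    refine ⟨hZ, hunif, (eLpNorm G 2 P * C).toNNReal, fun n => ?_⟩
    rw [ENNReal.coe_toNNReal (ENNReal.mul_ne_top hG.2.ne ENNReal.coe_ne_top)]
    simpa using key n univ MeasurableSet.univ
  have hY : Integrable Y P := hUI.integrable_of_ae_tendsto hlim
  refine ⟨hY, ?_⟩
  have hL := tendsto_Lp_finite_of_tendsto_ae le_rfl ENNReal.one_ne_top hZ
    (memLp_one_iff_integrable.2 hY) hunif hlim
  exact tendsto_integral_of_L1' Y hY.1
    (Eventually.of_forall fun n => memLp_one_iff_integrable.1 (hUI.memLp n)) hL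

end Vitali

/-! ### Averages over shrinking intervals. -/

section Averages

lemma tendsto_average_Ioc {J : ℝ → ℝ} (hJ : Continuous J) (a : ℝ) {δ : ℕ → ℝ} (hδ : ∀ n, 0 < δ n)
    (hlim : Tendsto δ atTop (𝓝 0)) :
    Tendsto (fun n => (2 * δ n)⁻¹ * ∫ z in Ioc (a - δ n) (a + δ n), J z) atTop (𝓝 (J a)) := by
  rw [Metric.tendsto_atTop]
  intro ε hε
  obtain ⟨r, hr, h⟩ := Metric.continuous_iff.1 hJ a (ε / 2) (by positivity)
  obtain ⟨N, hN⟩ := Metric.tendsto_atTop.1 hlim r hr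
  refine ⟨N, fun n hn => ?_⟩
  have hd := hN n hn
  rw [Real.dist_eq, sub_zero, abs_of_pos (hδ n)] at hd
  have hle : a - δ n ≤ a + δ n := by linarith [hδ n]
  have h1 : (2 * δ n)⁻¹ * (∫ z in Ioc (a - δ n) (a + δ n), J z) - J a =
      (2 * δ n)⁻¹ * ∫ z in (a - δ n)..(a + δ n), (J z - J a) := by
    rw [intervalIntegral.integral_sub (hJ.intervalIntegrable _ _) intervalIntegrable_const,
      intervalIntegral.integral_of_le hle, intervalIntegral.integral_const, smul_eq_mul]
    have := (hδ n).ne'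
    field_simp
    ring
  have h2 := intervalIntegral.norm_integral_le_of_norm_le_const (a := a - δ n) (b := a + δ n)
    (f := fun z => J z - J a) (C := ε / 2) (fun z hz => by
      rw [uIoc_of_le hle] at hz
      refine (h z ?_).le
      rw [Real.dist_eq, abs_lt]
      constructor <;> linarith [hz.1, hz.2])
  rw [Real.dist_eq, h1, abs_mul, abs_of_pos (inv_pos.2 (mul_pos two_pos (hδ n)))]
  rw [Real.norm_eq_abs, show a + δ n - (a - δ n) = 2 * δ n by ring,
    abs_of_pos (mul_pos two_pos (hδ n))] at h2
  calc _ ≤ (2 * δ n)⁻¹ * (ε / 2 * (2 * δ n)) :=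
        mul_le_mul_of_nonneg_left h2 (inv_pos.2 (mul_pos two_pos (hδ n))).le
    _ = ε / 2 := by have := (hδ n).ne'; field_simp
    _ < ε := by linarith

end Averages

/-! ### Stieltjes integrals against local time. -/

section LocalTimePaths

lemma stieltjesMeasure_Ioc {f : ℝ → ℝ} (hf : MonotoneOn f (Icc 0 1)) (hc : ContinuousOn f (Icc 0 1))
    {x y : ℝ} (hx : x ∈ Icc (0 : ℝ) 1) (hy : y ∈ Icc (0 : ℝ) 1) :
    stieltjesMeasure f (Ioc x y) = ENNReal.ofReal (f y - f x) := by
  have hcont : Continuous fun x : ℝ => f (projIcc 0 1 zero_le_one x) :=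
    hc.comp_continuous (continuous_subtype_val.comp continuous_projIcc) fun x => (projIcc _ _ _ x).2
  have hmono : Monotone fun x : ℝ => f (projIcc 0 1 zero_le_one x) := fun _ _ hxy =>
    hf (projIcc 0 1 zero_le_one _).2 (projIcc 0 1 zero_le_one _).2
        (monotone_projIcc zero_le_one hxy)
  have hval : ∀ z ∈ Icc (0 : ℝ) 1, hmono.stieltjesFunction z = f z := by
    intro z hz
    rw [hmono.stieltjesFunction_eq]
    have h1 := (hcont.continuousAt (x := z)).continuousWithinAt.rightLim_eq
    rw [h1, projIcc_of_mem _ hz]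
  rw [stieltjesMeasure, dif_pos hf]
  rw [StieltjesFunction.measure_Ioc, hval x hx, hval y hy]

/-- `b ↦ ∫ g dL^b` is continuous when `L` is jointly continuous. -/
lemma continuous_integral_stieltjesMeasure {ℓ : ℝ → ℝ → ℝ}
    (hc : ContinuousOn (fun p : ℝ × ℝ => ℓ p.1 p.2) (univ ×ˢ Icc 0 1))
    (hm : ∀ b, MonotoneOn (ℓ b) (Icc 0 1)) {g : ℝ → ℝ} (hg : Continuous g) :
    Continuous fun b => ∫ s in Ioc 0 1, g s ∂(stieltjesMeasure (ℓ b)) := by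
  have hcθ : ∀ b, ContinuousOn (ℓ b) (Icc 0 1) := fun b =>
    hc.comp (f := fun θ : ℝ => (b, θ)) (by fun_prop) fun θ hθ => ⟨mem_univ _, hθ⟩
  have hcb : ∀ θ ∈ Icc (0 : ℝ) 1, Continuous fun b => ℓ b θ := fun θ hθ =>
    hc.comp_continuous (f := fun b : ℝ => (b, θ)) (by fun_prop) fun b => ⟨mem_univ _, hθ⟩
  have h0 : (0 : ℝ) ∈ Icc (0 : ℝ) 1 := by simp
  have h1 : (1 : ℝ) ∈ Icc (0 : ℝ) 1 := by simp
  have hIoc : ∀ b, ∀ x ∈ Icc (0 : ℝ) 1, ∀ y ∈ Icc (0 : ℝ) 1,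
      stieltjesMeasure (ℓ b) (Ioc x y) = ENNReal.ofReal (ℓ b y - ℓ b x) := fun b x hx y hy =>
    stieltjesMeasure_Ioc (hm b) (hcθ b) hx hy
  rw [← continuousOn_univ]
  suffices h : ∀ a : ℝ, ContinuousOn (fun b => ∫ s in Ioc 0 1, g s ∂(stieltjesMeasure (ℓ b)))
      (Icc (a - 1) (a + 1)) by
    intro a _
    exact ((h a).continuousAt (Icc_mem_nhds (by linarith) (by linarith))).continuousWithinAt
  intro a
  -- `M` bounds the total mass `ℓ b 1 - ℓ b 0` uniformly over levels near `a`. The integral is then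
  -- a locally uniform limit of Riemann–Stieltjes sums, each continuous in `b`.
  obtain ⟨M, hM⟩ := isCompact_Icc.exists_bound_of_continuousOn (s := Icc (a - 1) (a + 1))
    ((hcb 1 h1).sub (hcb 0 h0)).continuousOn
  have hM0 : 0 ≤ M := (norm_nonneg _).trans (hM a ⟨by linarith, by linarith⟩)
  refine continuousOn_of_uniform_approx_of_continuousOn fun u hu => ?_
  obtain ⟨ε, hε, hεu⟩ := Metric.mem_uniformity_dist.1 hu
  obtain ⟨r, hr, hunif⟩ := Metric.uniformContinuousOn_iff.1
    (isCompact_Icc.uniformContinuousOn_of_continuous (hg.continuousOn (s := Icc (0:ℝ) 1)))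
    (ε / (M + 1)) (by positivity)
  obtain ⟨n, hn⟩ := exists_nat_one_div_lt hr
  have hn0 : (0 : ℝ) < n + 1 := by positivity
  set t : ℕ → ℝ := fun i => (i : ℝ) / (n + 1) with ht
  have htmem : ∀ i ≤ n + 1, t i ∈ Icc (0 : ℝ) 1 := fun i hi =>
    ⟨by positivity, by rw [ht, div_le_one hn0]; exact_mod_cast hi⟩
  have htle : ∀ i, t i ≤ t (i + 1) := fun i => by
    simp only [ht]; gcongr; linarith
  have hstep : ∀ i, t (i + 1) = t i + 1 / (n + 1) := fun i => by
    simp only [ht]; push_cast; ring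
  have ht0 : t 0 = 0 := by simp [ht]
  have ht1 : t (n + 1) = 1 := by simp only [ht]; push_cast; field_simp
  refine ⟨fun b => ∑ i ∈ Finset.range (n + 1), g (t i) * (ℓ b (t (i + 1)) - ℓ b (t i)), ?_, ?_⟩
  · refine (continuous_finsetSum _ fun i hi => ?_).continuousOn
    have hi' := Finset.mem_range.1 hi
    exact continuous_const.mul ((hcb _ (htmem _ hi')).sub (hcb _ (htmem _ hi'.le)))
  intro b hb
  refine hεu ?_
  set ν := stieltjesMeasure (ℓ b) with hν
  have hfin : ∀ i < n + 1, ν (Ioc (t i) (t (i + 1))) < ∞ := fun i hi => by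
    rw [hIoc b _ (htmem i hi.le) _ (htmem _ hi)]; exact ENNReal.ofReal_lt_top
  have hreal : ∀ i < n + 1, ν.real (Ioc (t i) (t (i + 1))) = ℓ b (t (i + 1)) - ℓ b (t i) := by
    intro i hi
    rw [measureReal_def, hIoc b _ (htmem i hi.le) _ (htmem _ hi), ENNReal.toReal_ofReal]
    exact sub_nonneg.2 (hm b (htmem i hi.le) (htmem _ hi) (htle i))
  have hgint : ∀ i < n + 1, IntegrableOn g (Ioc (t i) (t (i + 1))) ν := by
    intro i hi
    obtain ⟨C, hC⟩ := isCompact_Icc.exists_bound_of_continuousOn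
      (hg.continuousOn (s := Icc (t i) (t (i + 1))))
    exact Measure.integrableOn_of_bounded (hfin i hi).ne hg.aestronglyMeasurable
      ((ae_restrict_iff' measurableSet_Ioc).2
        (Eventually.of_forall fun x hx => hC x (Ioc_subset_Icc_self hx)))
  have hsplit : ∫ s in Ioc 0 1, g s ∂ν =
      ∑ i ∈ Finset.range (n + 1), ∫ s in Ioc (t i) (t (i + 1)), g s ∂ν := by
    have := intervalIntegral.sum_integral_adjacent_intervals (μ := ν) (f := g) (a := t)
      (n := n + 1) (fun i hi => (intervalIntegrable_iff_integrableOn_Ioc_of_le (htle i)).2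
        (hgint i hi))
    rw [ht0, ht1, intervalIntegral.integral_of_le zero_le_one] at this
    rw [← this]
    exact Finset.sum_congr rfl fun i _ => intervalIntegral.integral_of_le (htle i)
  have hcell : ∀ i < n + 1, |(∫ s in Ioc (t i) (t (i + 1)), g s ∂ν) -
      g (t i) * (ℓ b (t (i + 1)) - ℓ b (t i))| ≤
        ε / (M + 1) * (ℓ b (t (i + 1)) - ℓ b (t i)) := by
    intro i hi
    have e : (∫ s in Ioc (t i) (t (i + 1)), g s ∂ν) - g (t i) * (ℓ b (t (i + 1)) - ℓ b (t i)) =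
        ∫ s in Ioc (t i) (t (i + 1)), (g s - g (t i)) ∂ν := by
      rw [integral_sub (hgint i hi) (integrableOn_const (hfin i hi).ne), setIntegral_const,
        hreal i hi, smul_eq_mul, mul_comm (g (t i))]
    rw [e, ← hreal i hi]
    rw [← Real.norm_eq_abs]
    refine norm_setIntegral_le_of_norm_le_const (hfin i hi) fun s hs => ?_
    have hs01 : s ∈ Icc (0 : ℝ) 1 :=
      ⟨(htmem i hi.le).1.trans hs.1.le, hs.2.trans (htmem _ hi).2⟩
    refine (hunif s hs01 (t i) (htmem i hi.le) ?_).le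
    rw [Real.dist_eq, abs_of_pos (sub_pos.2 hs.1)]
    have := hs.2
    rw [hstep] at this
    linarith
  rw [Real.dist_eq, hsplit, ← Finset.sum_sub_distrib]
  calc _ ≤ ∑ i ∈ Finset.range (n + 1), ε / (M + 1) * (ℓ b (t (i + 1)) - ℓ b (t i)) :=
        (Finset.abs_sum_le_sum_abs _ _).trans
          (Finset.sum_le_sum fun i hi => hcell i (Finset.mem_range.1 hi))
    _ = ε / (M + 1) * (ℓ b 1 - ℓ b 0) := by
        rw [← Finset.mul_sum, Finset.sum_range_sub (fun i => ℓ b (t i)), ht0, ht1]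
    _ ≤ ε / (M + 1) * M := by
        gcongr
        exact (le_abs_self _).trans (hM b hb)
    _ < ε := by
        rw [div_mul_eq_mul_div, div_lt_iff₀ (by positivity)]
        nlinarith

end LocalTimePaths

/-! ### The dominating variable and the occupation densities. -/

section Domination

variable {Ω : Type*} [MeasurableSpace Ω] {P : Measure Ω} {B : ℝ → Ω → ℝ}

/-- The variance `∫ (f - M)²`, with `M` the mean of `f`, is nonnegative. -/
lemma sq_integral_le {f : ℝ → ℝ} (hf : Continuous f) :
    (∫ x in (0 : ℝ)..1, f x) ^ 2 ≤ ∫ x in (0 : ℝ)..1, f x ^ 2 := by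
  set M := ∫ x in (0 : ℝ)..1, f x with hM
  have h0 : 0 ≤ ∫ x in (0 : ℝ)..1, (f x - M) ^ 2 :=
    intervalIntegral.integral_nonneg zero_le_one fun x _ => sq_nonneg _
  have h1 : ∫ x in (0 : ℝ)..1, (f x - M) ^ 2 =
      (∫ x in (0 : ℝ)..1, f x ^ 2) - 2 * M * M + M ^ 2 := by
    have e : ∀ x, (f x - M) ^ 2 = f x ^ 2 - 2 * M * f x + M ^ 2 := fun x => by ring
    simp_rw [e]
    rw [intervalIntegral.integral_add, intervalIntegral.integral_sub,
      intervalIntegral.integral_const_mul, ← hM, intervalIntegral.integral_const]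
    · simp
    all_goals exact Continuous.intervalIntegrable (by fun_prop) _ _
  nlinarith

lemma pow_four_le_exp_add_exp (x : ℝ) : x ^ 4 ≤ 24 * (Real.exp x + Real.exp (-x)) := by
  have h := Real.pow_div_factorial_le_exp |x| (abs_nonneg x) 4
  have h4 : |x| ^ 4 = x ^ 4 := by rw [Even.pow_abs (by decide)]
  rw [h4] at h
  have h2 : Real.exp |x| ≤ Real.exp x + Real.exp (-x) := Real.exp_abs_le x
  norm_num [Nat.factorial] at h
  linarith

/-- The square is controlled by `∫ exp (2⟨B,k⟩ ± B_σ) dσ`. These exponents are linear functionals of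
`B`, and their exponential moments are continuous in `σ`. -/
lemma IsRegularBrownian.memLp_exp_mul [IsProbabilityMeasure P] (hB : IsRegularBrownian B P)
    {k : ℝ → ℝ} (hk : Continuous k) :
    MemLp (fun ω => Real.exp (scalarProd (fun σ => B σ ω) k) *
      (1 + ∫ σ in (0 : ℝ)..1, B σ ω ^ 2)) 2 P := by
  have hk2 : Continuous fun σ => 2 * k σ := by fun_prop
  have hexp : ∀ r σ, ∀ ω, linFun B (fun σ => 2 * k σ) r σ ω =
      2 * scalarProd (fun σ => B σ ω) k + r * B σ ω := by
    intro r σ ω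
    have := hB.linFun_add_mul (f := fun _ => 0) continuous_const hk 2 r σ ω
    simp only [zero_add] at this
    rw [this]
    simp [scalarProd]
  have hBm := hB.measurable_uncurry
  have hUm := hB.measurable_scalarProd hk
  set F : ℝ → Ω → ℝ := fun σ ω => Real.exp (linFun B (fun σ => 2 * k σ) 1 σ ω) +
    Real.exp (linFun B (fun σ => 2 * k σ) (-1) σ ω) with hF
  have hFm : Measurable (Function.uncurry F) := by
    have h1 : Measurable fun p : ℝ × Ω => B p.1 p.2 := hBm
    have h2 : Measurable fun p : ℝ × Ω => scalarProd (fun σ => B σ p.2) k := hUm.comp measurable_snd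
    simp only [hF, hexp, Function.uncurry_def]
    fun_prop
  have hFint : Integrable (Function.uncurry F) ((volume.restrict (Ioc (0 : ℝ) 1)).prod P) := by
    rw [integrable_prod_iff hFm.aestronglyMeasurable]
    have hi : ∀ σ ∈ Ioc (0 : ℝ) 1, ∀ r, Integrable
        (fun ω => Real.exp (linFun B (fun σ => 2 * k σ) r σ ω)) P := fun σ hσ r =>
      (hB.integral_exp_linFun hk2 r (Ioc_subset_Icc_self hσ)).1
    constructor
    · filter_upwards [ae_restrict_mem measurableSet_Ioc] with σ hσ
      exact (hi σ hσ 1).add (hi σ hσ (-1))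
    · have hcont : Continuous fun σ => Real.exp (linVar (fun σ => 2 * k σ) 1 σ / 2) +
          Real.exp (linVar (fun σ => 2 * k σ) (-1) σ / 2) := by
        have := continuous_covOp hk2
        unfold linVar
        fun_prop
      refine ((hcont.integrableOn_Icc (a := 0) (b := 1)).mono_set Ioc_subset_Icc_self).congr ?_
      filter_upwards [ae_restrict_mem measurableSet_Ioc] with σ hσ
      have hn : ∀ ω, ‖Function.uncurry F (σ, ω)‖ = F σ ω := fun ω =>
        Real.norm_of_nonneg (by simp only [hF, Function.uncurry]; positivity)
      simp_rw [hn, hF]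
      rw [integral_add (hi σ hσ 1) (hi σ hσ (-1)),
        (hB.integral_exp_linFun hk2 1 (Ioc_subset_Icc_self hσ)).2,
        (hB.integral_exp_linFun hk2 (-1) (Ioc_subset_Icc_self hσ)).2]
  have hF1 : Integrable (fun ω => ∫ σ in Ioc (0 : ℝ) 1, F σ ω) P := hFint.integral_prod_right
  have hSm : Measurable fun ω => ∫ σ in (0 : ℝ)..1, B σ ω ^ 2 := by
    simp_rw [intervalIntegral.integral_of_le zero_le_one]
    have : Measurable (Function.uncurry fun (ω : Ω) (σ : ℝ) => B σ ω ^ 2) :=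
      (hBm.comp measurable_swap).pow_const 2
    exact this.stronglyMeasurable.integral_prod_right.measurable
  have hm : Measurable (fun ω => Real.exp (scalarProd (fun σ => B σ ω) k) *
      (1 + ∫ σ in (0 : ℝ)..1, B σ ω ^ 2)) := by fun_prop
  rw [memLp_two_iff_integrable_sq hm.aestronglyMeasurable]
  refine (hF1.const_mul 50).mono' (hm.pow_const 2).aestronglyMeasurable
    (Eventually.of_forall fun ω => ?_)
  have hp := hB.path ω
  rw [Real.norm_of_nonneg (sq_nonneg _), mul_pow, ← Real.exp_nat_mul]
  -- With `b = B σ ω`: `(1 + b²)² ≤ 2 + 2b⁴`, where `2 ≤ e^b + e^(-b)` and `b⁴ ≤ 24 (e^b + e^(-b))`;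
  -- so `49` would do.
  have e1 : (1 + ∫ σ in (0 : ℝ)..1, B σ ω ^ 2) ^ 2 ≤
      ∫ σ in (0 : ℝ)..1, 50 * (Real.exp (B σ ω) + Real.exp (-B σ ω)) := by
    have h1 := sq_integral_le (f := fun σ => 1 + B σ ω ^ 2) (by fun_prop)
    rw [intervalIntegral.integral_add intervalIntegrable_const
      (Continuous.intervalIntegrable (by fun_prop) _ _)] at h1
    simp only [intervalIntegral.integral_const, sub_zero, smul_eq_mul, mul_one] at h1
    refine h1.trans (intervalIntegral.integral_mono_on zero_le_one
      (Continuous.intervalIntegrable (by fun_prop) _ _)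
      (Continuous.intervalIntegrable (by fun_prop) _ _) fun σ _ => ?_)
    have h2 := pow_four_le_exp_add_exp (B σ ω)
    have h3 : 2 ≤ Real.exp (B σ ω) + Real.exp (-B σ ω) := by
      linarith [Real.add_one_le_exp (B σ ω), Real.add_one_le_exp (-B σ ω)]
    nlinarith [sq_nonneg (B σ ω ^ 2 - 1)]
  calc _ ≤ Real.exp ((2 : ℕ) * scalarProd (fun σ => B σ ω) k) *
        ∫ σ in (0 : ℝ)..1, 50 * (Real.exp (B σ ω) + Real.exp (-B σ ω)) := by gcongr
    _ = 50 * ∫ σ in (0 : ℝ)..1, F σ ω := by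
      rw [← intervalIntegral.integral_const_mul, ← intervalIntegral.integral_const_mul]
      refine intervalIntegral.integral_congr fun σ _ => ?_
      simp only [hF, hexp, Real.exp_add]
      push_cast
      rw [one_mul, neg_one_mul]
      ring
    _ = _ := by rw [intervalIntegral.integral_of_le zero_le_one]

/-- The normalised time that a Brownian motion spends in `(a-δ, a+δ]` during `[η, 1]`. -/
noncomputable def occupationDensity (B : ℝ → Ω → ℝ) (η a δ : ℝ) (ω : Ω) : ℝ :=
  (2 * δ)⁻¹ * (∫⁻ s in Icc η 1, (B s ⁻¹' Ioc (a - δ) (a + δ)).indicator 1 ω : ℝ≥0∞).toReal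

lemma IsRegularBrownian.measurable_indicator (hB : IsRegularBrownian B P) {A : Set ℝ}
    (hA : MeasurableSet A) :
    Measurable fun p : Ω × ℝ => (B p.2 ⁻¹' A).indicator (1 : Ω → ℝ≥0∞) p.1 := by
  have h1 : MeasurableSet {p : Ω × ℝ | B p.2 p.1 ∈ A} :=
    (hB.measurable_uncurry.comp measurable_swap) hA
  exact measurable_one.indicator h1

lemma IsRegularBrownian.measurable_occupationDensity (hB : IsRegularBrownian B P) (η a δ : ℝ) :
    Measurable (occupationDensity B η a δ) := by
  unfold occupationDensity
  refine Measurable.const_mul (Measurable.ennreal_toReal ?_) _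
  exact (hB.measurable_indicator measurableSet_Ioc).lintegral_prod_right'

/-- The normalisation `1 / (4δ²)` cancels the `δ²` of the second moment, so the bound does not
depend on `δ`. -/
lemma IsRegularBrownian.eLpNorm_occupationDensity_le [IsProbabilityMeasure P]
    (hB : IsRegularBrownian B P) {η : ℝ} (a : ℝ) (hη : 0 < η) :
    ∃ C : ℝ≥0, ∀ δ > 0, eLpNorm (occupationDensity B η a δ) 2 P ≤ C := by
  set S : ℝ≥0∞ := ∫⁻ u in Icc (-1 : ℝ) 1, ENNReal.ofReal (1 / √|u|) with hS
  have hSfin : ENNReal.ofReal (2 / √η) * S < ∞ :=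
    ENNReal.mul_lt_top ENNReal.ofReal_lt_top lintegral_inv_sqrt_lt_top
  refine ⟨((ENNReal.ofReal (2 / √η) * S) ^ (1 / 2 : ℝ)).toNNReal, fun δ hδ => ?_⟩
  rw [ENNReal.coe_toNNReal (ENNReal.rpow_lt_top_of_nonneg (by norm_num) hSfin.ne).ne,
    eLpNorm_eq_lintegral_rpow_enorm_toReal (by simp) (by simp)]
  simp only [ENNReal.toReal_ofNat, ENNReal.rpow_ofNat]
  refine ENNReal.rpow_le_rpow ?_ (by norm_num)
  calc _ ≤ ∫⁻ ω, ENNReal.ofReal (1 / (4 * δ ^ 2)) *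
        (∫⁻ s in Icc η 1, (B s ⁻¹' Ioc (a - δ) (a + δ)).indicator 1 ω) ^ 2 ∂P := by
        refine lintegral_mono fun ω => ?_
        simp only [occupationDensity]
        rw [enorm_mul, mul_pow]
        refine mul_le_mul' (le_of_eq ?_) (pow_le_pow_left' ?_ 2)
        · rw [Real.enorm_of_nonneg (by positivity), ← ENNReal.ofReal_pow (by positivity)]
          congr 1
          field_simp
          norm_num
        · rw [Real.enorm_of_nonneg ENNReal.toReal_nonneg]
          exact ENNReal.ofReal_toReal_le
    _ ≤ ENNReal.ofReal (1 / (4 * δ ^ 2)) * (ENNReal.ofReal (8 * δ ^ 2 / √η) * S) := by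
        rw [lintegral_const_mul' _ _ ENNReal.ofReal_ne_top]
        exact mul_le_mul_right (hB.lintegral_sq_occupation_le a hη hδ) _
    _ = _ := by
        rw [← mul_assoc, ← ENNReal.ofReal_mul (by positivity)]
        congr 2
        field_simp
        norm_num

end Domination

/-! ### The exact formula for a fixed kernel. -/

section Expectation

lemma continuous_scalarProd_left {ℓ : ℝ → ℝ} (hℓ : Continuous ℓ) {m : ℝ → ℝ → ℝ}
    (hm : Continuous (Function.uncurry m)) : Continuous fun s => scalarProd ℓ (m s) := by
  unfold scalarProd
  exact intervalIntegral.continuous_parametric_intervalIntegral_of_continuous' (by fun_prop) 0 1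

lemma continuous_covOp_uncurry {m : ℝ → ℝ → ℝ} (hm : Continuous (Function.uncurry m)) :
    Continuous fun p : ℝ × ℝ => covOp (m p.1) p.2 := by
  unfold covOp
  exact intervalIntegral.continuous_parametric_intervalIntegral_of_continuous'
    (f := fun (p : ℝ × ℝ) σ => min p.2 σ * m p.1 σ) (by fun_prop) 0 1

lemma continuous_scalarProd_covOp {m : ℝ → ℝ → ℝ} (hm : Continuous (Function.uncurry m)) :
    Continuous fun s => scalarProd (covOp (m s)) (m s) := by
  have := continuous_covOp_uncurry hm
  unfold scalarProd
  exact intervalIntegral.continuous_parametric_intervalIntegral_of_continuous'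
    (f := fun s σ => covOp (m s) σ * m s σ) (by fun_prop) 0 1

lemma abs_scalarProd_covOp_le {m : ℝ → ℝ} {C : ℝ} (hC : ∀ σ, |m σ| ≤ C) :
    |scalarProd (covOp m) m| ≤ C ^ 2 := by
  have hC0 : 0 ≤ C := (abs_nonneg _).trans (hC 0)
  have h1 : ∀ θ ∈ Icc (0 : ℝ) 1, |covOp m θ| ≤ C := by
    intro θ hθ
    have := intervalIntegral.norm_integral_le_of_norm_le_const (a := (0 : ℝ)) (b := 1) (C := C)
      (f := fun σ => min θ σ * m σ) (fun σ hσ => by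
        rw [uIoc_of_le zero_le_one] at hσ
        rw [norm_mul, Real.norm_eq_abs, Real.norm_eq_abs, abs_of_nonneg (le_min hθ.1 hσ.1.le)]
        calc _ ≤ 1 * C := mul_le_mul (min_le_of_left_le hθ.2) (hC σ) (abs_nonneg _) zero_le_one
          _ = C := one_mul C)
    simpa [covOp] using this
  have := intervalIntegral.norm_integral_le_of_norm_le_const (a := (0 : ℝ)) (b := 1) (C := C ^ 2)
    (f := fun σ => covOp m σ * m σ) (fun σ hσ => by
      rw [uIoc_of_le zero_le_one] at hσ
      rw [norm_mul, Real.norm_eq_abs, Real.norm_eq_abs, sq]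
      exact mul_le_mul (h1 σ (Ioc_subset_Icc_self hσ)) (hC σ) (abs_nonneg _) hC0)
  simpa [scalarProd] using this

lemma sq_scalarProd_le {ℓ m : ℝ → ℝ} (hℓ : Continuous ℓ) (hm : Continuous m) {C : ℝ}
    (hC : ∀ σ, |m σ| ≤ C) : scalarProd ℓ m ^ 2 ≤ C ^ 2 * ∫ σ in (0 : ℝ)..1, ℓ σ ^ 2 := by
  refine (sq_integral_le (f := fun σ => ℓ σ * m σ) (by fun_prop)).trans ?_
  rw [← intervalIntegral.integral_const_mul]
  refine intervalIntegral.integral_mono_on zero_le_one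
    (Continuous.intervalIntegrable (by fun_prop) _ _)
    (Continuous.intervalIntegrable (by fun_prop) _ _) fun σ _ => ?_
  rw [mul_pow, mul_comm]
  have : m σ ^ 2 ≤ C ^ 2 := sq_le_sq.2 ((hC σ).trans (le_abs_self C))
  gcongr

lemma continuousAt_gaussianPDFReal_mul {K κ c : ℝ → ℝ} (hK : Continuous K) (hκ : Continuous κ)
    (hc : Continuous c) {s : ℝ} (hs : 0 < s) (z : ℝ) :
    ContinuousAt (fun p : ℝ × ℝ => gaussianPDFReal (K p.1) p.1.toNNReal p.2 *
      ((κ p.1 + c p.1 / p.1 * (p.2 - K p.1)) ^ 2 - (c p.1 / p.1) ^ 2 * p.1)) (s, z) := by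
  have hmax : 0 < max s 0 := lt_max_of_lt_left hs
  have hmc : ContinuousAt (fun p : ℝ × ℝ => max p.1 0) (s, z) :=
    (continuous_fst.max continuous_const).continuousAt
  have hd : ContinuousAt (fun p : ℝ × ℝ => c p.1 / p.1) (s, z) :=
    ContinuousAt.div (by fun_prop) (by fun_prop) hs.ne'
  simp only [gaussianPDFReal_def, Real.coe_toNNReal']
  refine ContinuousAt.mul (ContinuousAt.mul ?_ ?_) ?_
  · refine ContinuousAt.inv₀ (by fun_prop) ?_
    simp only
    positivity
  · refine (ContinuousAt.div (by fun_prop) (by fun_prop) ?_).rexp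
    simp only
    positivity
  · fun_prop

/-- A continuous function of `(s, z)` on `(0,∞) × ℝ`, times a function of `s` supported in
`(0, 1)`, is continuous. -/
lemma continuous_mul_wickDensity {k : ℝ → ℝ} (hk : Continuous k) {m : ℝ → ℝ → ℝ}
    (hm : Continuous (Function.uncurry m)) {h : ℝ → ℝ} (hcont : Continuous h)
    (hsupp : tsupport h ⊆ Ioo 0 1) :
    Continuous (Function.uncurry fun s z => h s * wickDensity k (m s) s z) := by
  rw [continuous_iff_continuousAt]
  rintro ⟨s, z⟩
  by_cases hs : s ∈ tsupport h
  · have hs0 : 0 < s := (hsupp hs).1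
    have hK := continuous_covOp hk
    have hκ := continuous_scalarProd_left (continuous_covOp hk) hm
    have hc : Continuous fun s => covOp (m s) s :=
      (continuous_covOp_uncurry hm).comp (f := fun s : ℝ => (s, s)) (by fun_prop)
    exact (hcont.comp continuous_fst).continuousAt.mul
      (continuousAt_gaussianPDFReal_mul hK hκ hc hs0 z)
  · have h0 : h =ᶠ[𝓝 s] 0 := notMem_tsupport_iff_eventuallyEq.1 hs
    have h1 : (Function.uncurry fun s z => h s * wickDensity k (m s) s z) =ᶠ[𝓝 (s, z)]
        fun _ => 0 := by
      have h2 := (continuous_fst.tendsto ((s, z) : ℝ × ℝ)).eventually h0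
      filter_upwards [h2] with p hp
      simp only [Function.uncurry]
      rw [hp]
      simp
    exact continuousAt_const.congr h1.symm

/-- The gap `η` at `0` is needed for the occupation estimates; the gaps at both ends keep mollifiers
with `ε < η` inside `[0,1]`. -/
lemma exists_pos_le_of_tsupport_subset {h : ℝ → ℝ} (hcpt : HasCompactSupport h)
    (hsupp : tsupport h ⊆ Ioo 0 1) : ∃ η > 0, ∀ s ∈ tsupport h, η ≤ s ∧ s ≤ 1 - η := by
  by_cases hne : (tsupport h).Nonempty
  · obtain ⟨x, hx, hxmin⟩ := hcpt.isCompact.exists_isMinOn hne continuousOn_id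
    obtain ⟨y, hy, hymax⟩ := hcpt.isCompact.exists_isMaxOn hne continuousOn_id
    refine ⟨min x (1 - y), lt_min (hsupp hx).1 (sub_pos.2 (hsupp hy).2), fun s hs => ?_⟩
    have h1 : x ≤ s := hxmin hs
    have h2 : s ≤ y := hymax hs
    exact ⟨(min_le_left _ _).trans h1, by linarith [min_le_right x (1 - y)]⟩
  · exact ⟨1, one_pos, fun s hs => (hne ⟨s, hs⟩).elim⟩

variable {Ω : Type*} [MeasurableSpace Ω] {P : Measure Ω} {B : ℝ → Ω → ℝ}

/-- `∫_0^1 h_s ((∫ m_s B)² - E (∫ m_s B)²) dL^a_s`. -/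
noncomputable def wickIntegral (P : Measure Ω) (B : ℝ → Ω → ℝ) (L : ℝ → ℝ → Ω → ℝ)
    (m : ℝ → ℝ → ℝ) (h : ℝ → ℝ) (a : ℝ) (ω : Ω) : ℝ :=
  ∫ θ in Icc (0 : ℝ) 1, h θ * (scalarProd (fun σ => B σ ω) (m θ) ^ 2 -
    ∫ ω', scalarProd (fun σ => B σ ω') (m θ) ^ 2 ∂P) ∂(stieltjesMeasure fun θ => L a θ ω)

/-- The occupation times formula, localised at the level `a`. -/
lemma IsLocalTime.tendsto_average {L : ℝ → ℝ → Ω → ℝ} (hL : IsLocalTime B L P) (a : ℝ)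
    {δ : ℕ → ℝ} (hδ : ∀ n, 0 < δ n) (hlim : Tendsto δ atTop (𝓝 0)) :
    ∀ᵐ ω ∂P, ∀ g : ℝ → ℝ, Continuous g → HasCompactSupport g →
      Tendsto (fun n => (2 * δ n)⁻¹ * ∫ s in (0 : ℝ)..1,
        g s * (Ioc (a - δ n) (a + δ n)).indicator 1 (B s ω)) atTop
        (𝓝 (∫ s in Ioc 0 1, g s ∂(stieltjesMeasure fun θ => L a θ ω))) := by
  filter_upwards [hL.cont, hL.mono, hL.occupation] with ω hc hm hocc g hg hgc
  have hJ := continuous_integral_stieltjesMeasure hc hm hg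
  refine (tendsto_average_Ioc hJ a hδ hlim).congr fun n => ?_
  congr 1
  set A := Ioc (a - δ n) (a + δ n) with hA
  obtain ⟨M, hM⟩ := hgc.exists_bound_of_continuous hg
  -- For this test function the occupation formula turns the time integral into the integral of `b ↦
  -- ∫ g dL^b` over the window `A`.
  have h1 := hocc (fun p => g p.1 * A.indicator 1 p.2)
    ((hg.measurable.comp measurable_fst).mul
      ((measurable_one.indicator measurableSet_Ioc).comp measurable_snd))
    ⟨M, fun p => by
      by_cases hp : p.2 ∈ A
      · simpa [hp] using hM p.1
      · simpa [hp] using (norm_nonneg _).trans (hM p.1)⟩ 1 (by simp)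
  rw [h1, ← integral_indicator measurableSet_Ioc, ← hA]
  congr 1
  funext b
  by_cases hb : b ∈ A
  · simp only [indicator_of_mem hb, Pi.one_apply, mul_one]
  · simp only [indicator_of_notMem hb, mul_zero, integral_zero]

/-- Replace `dL^a` by normalised occupation of a window of half-width `δ`. The expectations converge
to the left side by uniform integrability; computed time by time, they are window averages of a
continuous function of the level, so they converge to the right side. -/
theorem IsRegularBrownian.integral_exp_mul_wickIntegral [IsProbabilityMeasure P]
    (hB : IsRegularBrownian B P) {L : ℝ → ℝ → Ω → ℝ} (hL : IsLocalTime B L P) (a : ℝ)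
    {h : ℝ → ℝ} (hcont : Continuous h) (hcpt : HasCompactSupport h)
    (hsupp : tsupport h ⊆ Ioo 0 1) {k : ℝ → ℝ} (hk : Continuous k) {m : ℝ → ℝ → ℝ}
    (hm : Continuous (Function.uncurry m)) {C : ℝ} (hC : ∀ s σ, |m s σ| ≤ C) :
    Integrable (fun ω => Real.exp (scalarProd (fun σ => B σ ω) k) *
      wickIntegral P B L m h a ω) P ∧
    ∫ ω, Real.exp (scalarProd (fun σ => B σ ω) k) * wickIntegral P B L m h a ω ∂P =
      Real.exp (scalarProd (covOp k) k / 2) *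
        ∫ s in (0 : ℝ)..1, h s * wickDensity k (m s) s a := by
  obtain ⟨η, hη, hηs⟩ := exists_pos_le_of_tsupport_subset hcpt hsupp
  obtain ⟨H, hH⟩ := hcpt.exists_bound_of_continuous hcont
  have hH0 : 0 ≤ H := (norm_nonneg _).trans (hH 0)
  have hms : ∀ s, Continuous (m s) := fun s => hm.comp (f := fun σ : ℝ => (s, σ)) (by fun_prop)
  set v : ℝ → ℝ := fun s => scalarProd (covOp (m s)) (m s) with hv
  have hvcont : Continuous v := continuous_scalarProd_covOp hm
  have hvar : ∀ s, ∫ ω, scalarProd (fun σ => B σ ω) (m s) ^ 2 ∂P = v s := fun s =>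
    hB.integral_sq_scalarProd (hms s)
  set w : ℝ → Ω → ℝ := fun s ω => scalarProd (fun σ => B σ ω) (m s) ^ 2 - v s with hw
  have hwcont : ∀ ω, Continuous fun s => w s ω := fun ω =>
    ((continuous_scalarProd_left (hB.path ω) hm).pow 2).sub hvcont
  have hwmeas : Measurable (Function.uncurry w) := measurable_uncurry_of_continuous_of_measurable
    hwcont fun s => ((hB.measurable_scalarProd (hms s)).pow_const 2).sub_const _
  set S : Ω → ℝ := fun ω => 1 + ∫ σ in (0 : ℝ)..1, B σ ω ^ 2 with hS
  have hwb : ∀ s ω, |w s ω| ≤ C ^ 2 * S ω := by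
    intro s ω
    have h1 := sq_scalarProd_le (hB.path ω) (hms s) (hC s)
    have h2 := abs_scalarProd_covOp_le (hC s)
    refine (abs_sub _ _).trans ?_
    rw [abs_of_nonneg (sq_nonneg _)]
    simp only [hS, hv]
    linarith
  set E : Ω → ℝ := fun ω => Real.exp (scalarProd (fun σ => B σ ω) k) with hE
  have hEmeas : Measurable E := (hB.measurable_scalarProd hk).exp
  set δ : ℕ → ℝ := fun n => 1 / ((n : ℝ) + 1) with hδdef
  have hδ : ∀ n, 0 < δ n := fun n => by positivity
  have hδlim : Tendsto δ atTop (𝓝 0) := tendsto_one_div_add_atTop_nhds_zero_nat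
  set A : ℕ → Set ℝ := fun n => Ioc (a - δ n) (a + δ n) with hA
  have hAm : ∀ n, MeasurableSet (A n) := fun n => measurableSet_Ioc
  have hindm : ∀ n, Measurable fun p : ℝ × Ω => (A n).indicator (1 : ℝ → ℝ) (B p.1 p.2) := fun n =>
    (measurable_one.indicator (hAm n)).comp hB.measurable_uncurry
  set F : ℕ → ℝ → Ω → ℝ := fun n s ω => h s * w s ω * (A n).indicator 1 (B s ω) with hF
  have hFm : ∀ n, Measurable (Function.uncurry (F n)) := fun n =>
    ((hcont.measurable.comp measurable_fst).mul hwmeas).mul (hindm n)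
  set Z : ℕ → Ω → ℝ := fun n ω => E ω * ((2 * δ n)⁻¹ * ∫ s in (0 : ℝ)..1, F n s ω) with hZ
  have hZm : ∀ n, Measurable (Z n) := by
    intro n
    refine hEmeas.mul (Measurable.const_mul ?_ _)
    simp_rw [intervalIntegral.integral_of_le zero_le_one]
    have : Measurable (Function.uncurry fun (ω : Ω) (s : ℝ) => F n s ω) :=
      (hFm n).comp measurable_swap
    exact this.stronglyMeasurable.integral_prod_right.measurable
  have hlim : ∀ᵐ ω ∂P, Tendsto (fun n => Z n ω) atTop
      (𝓝 (E ω * wickIntegral P B L m h a ω)) := by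
    filter_upwards [hL.tendsto_average a hδ hδlim] with ω hω
    have h1 := hω (fun s => h s * w s ω) (hcont.mul (hwcont ω)) hcpt.mul_right
    have h2 : wickIntegral P B L m h a ω =
        ∫ s in Ioc 0 1, h s * w s ω ∂(stieltjesMeasure fun θ => L a θ ω) := by
      unfold wickIntegral
      simp_rw [hvar]
      -- The closed and half-open intervals differ by the point `0`, outside the support of `h`.
      refine (setIntegral_eq_of_subset_of_forall_sdiff_eq_zero measurableSet_Icc
        Ioc_subset_Icc_self fun x hx => ?_)
      have hx0 : x ∉ tsupport h := fun hx' => hx.2 ⟨(hsupp hx').1, hx.1.2⟩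
      rw [image_eq_zero_of_notMem_tsupport hx0, zero_mul]
    rw [h2]
    exact h1.const_mul _
  set G : Ω → ℝ := fun ω => H * C ^ 2 * (E ω * S ω) with hG
  have hGL : MemLp G 2 P := (hB.memLp_exp_mul hk).const_mul (H * C ^ 2)
  have hS0 : ∀ ω, 0 ≤ S ω := fun ω => by
    have : 0 ≤ ∫ σ in (0 : ℝ)..1, B σ ω ^ 2 :=
      intervalIntegral.integral_nonneg zero_le_one fun x _ => sq_nonneg _
    simp only [hS]; linarith
  have hG0 : ∀ ω, 0 ≤ G ω := fun ω => by
    have := hS0 ω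
    simp only [hG, hE]
    positivity
  -- The support of `h` confines `s` to `[η, 1]`, where the occupation density has its `L²` bound.
  have hFb : ∀ n s ω, ‖F n s ω‖ₑ ≤ ENNReal.ofReal (H * (C ^ 2 * S ω)) *
      (Icc η 1).indicator (fun s => (B s ⁻¹' A n).indicator (1 : Ω → ℝ≥0∞) ω) s := by
    intro n s ω
    by_cases hs : s ∈ tsupport h
    · have hsI : s ∈ Icc η 1 := ⟨(hηs s hs).1, (hsupp hs).2.le⟩
      rw [indicator_of_mem hsI]
      by_cases hA' : B s ω ∈ A n
      · have hA'' : ω ∈ B s ⁻¹' A n := hA'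
        rw [indicator_of_mem hA'']
        simp only [hF, indicator_of_mem hA', Pi.one_apply, mul_one]
        rw [← ofReal_norm, norm_mul]
        refine ENNReal.ofReal_le_ofReal ?_
        exact mul_le_mul (hH s) (hwb s ω) (norm_nonneg _) hH0
      · simp [hF, hA']
    · simp [hF, image_eq_zero_of_notMem_tsupport hs]
  obtain ⟨C', hC'⟩ := hB.eLpNorm_occupationDensity_le a hη
  have hb : ∀ n ω, |Z n ω| ≤ G ω * occupationDensity B η a (δ n) ω := by
    intro n ω
    set T : ℝ≥0∞ := ∫⁻ s in Icc η 1, (B s ⁻¹' A n).indicator 1 ω with hT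
    have hTfin : T ≠ ∞ := by
      refine ne_top_of_le_ne_top (b := volume (Icc η 1)) (by simp) ?_
      rw [hT, ← setLIntegral_one]
      exact lintegral_mono fun s => indicator_le_self' (fun _ _ => zero_le_one) ω
    have h1 : ‖∫ s in (0 : ℝ)..1, F n s ω‖ₑ ≤ ENNReal.ofReal (H * (C ^ 2 * S ω)) * T := by
      rw [intervalIntegral.integral_of_le zero_le_one]
      calc _ ≤ ∫⁻ s in Ioc 0 1, ‖F n s ω‖ₑ := enorm_integral_le_lintegral_enorm _
        _ ≤ ∫⁻ s, ‖F n s ω‖ₑ := setLIntegral_le_lintegral _ _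
        _ ≤ ∫⁻ s, ENNReal.ofReal (H * (C ^ 2 * S ω)) *
            (Icc η 1).indicator (fun s => (B s ⁻¹' A n).indicator (1 : Ω → ℝ≥0∞) ω) s :=
          lintegral_mono fun s => hFb n s ω
        _ = _ := by
          rw [lintegral_const_mul' _ _ ENNReal.ofReal_ne_top, lintegral_indicator measurableSet_Icc]
    have hnn : 0 ≤ H * (C ^ 2 * S ω) := mul_nonneg hH0 (mul_nonneg (sq_nonneg _) (hS0 ω))
    have h2 : |∫ s in (0 : ℝ)..1, F n s ω| ≤ H * (C ^ 2 * S ω) * T.toReal := by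
      have := ENNReal.toReal_mono (ENNReal.mul_ne_top ENNReal.ofReal_ne_top hTfin) h1
      rwa [toReal_enorm, ENNReal.toReal_mul, ENNReal.toReal_ofReal hnn] at this
    have hE0 : 0 < E ω := Real.exp_pos _
    have hd := hδ n
    simp only [hZ, hG, occupationDensity]
    rw [abs_mul, abs_mul, abs_of_pos hE0, abs_of_pos (by positivity : 0 < (2 * δ n)⁻¹)]
    calc _ ≤ E ω * ((2 * δ n)⁻¹ * (H * (C ^ 2 * S ω) * T.toReal)) := by gcongr
      _ = _ := by ring
  obtain ⟨hint, hconv⟩ := tendsto_integral_of_le_mul (fun n => (hZm n).aestronglyMeasurable) hlim hGL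
    (fun n => (hB.measurable_occupationDensity η a (δ n)).aestronglyMeasurable)
    (fun n => hC' _ (hδ n)) hb
  refine ⟨hint, tendsto_nhds_unique hconv ?_⟩
  set Φ : ℝ → ℝ → ℝ := fun s z => h s * wickDensity k (m s) s z with hΦ
  have hΦc : Continuous (Function.uncurry Φ) := continuous_mul_wickDensity hk hm hcont hsupp
  have hΦi : Continuous fun z => ∫ s in (0 : ℝ)..1, Φ s z :=
    intervalIntegral.continuous_parametric_intervalIntegral_of_continuous'
      (f := fun z s => Φ s z) (hΦc.comp continuous_swap) 0 1
  refine ((tendsto_average_Ioc hΦi a hδ hδlim).const_mul _).congr fun n => ?_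
  have hle : a - δ n ≤ a + δ n := by linarith [hδ n]
  -- Integrability of `G` alone justifies Fubini, since `δ n` is fixed here.
  have hFint : Integrable (Function.uncurry fun s ω => E ω * F n s ω)
      ((volume.restrict (uIoc (0 : ℝ) 1)).prod P) := by
    rw [uIoc_of_le zero_le_one]
    refine ((hGL.integrable one_le_two).comp_snd (volume.restrict (Ioc (0 : ℝ) 1))).mono'
      ((hEmeas.comp measurable_snd).mul (hFm n)).aestronglyMeasurable
      (Eventually.of_forall fun p => ?_)
    have hE0 : 0 < E p.2 := Real.exp_pos _
    simp only [Function.uncurry]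
    rw [norm_mul, Real.norm_of_nonneg hE0.le]
    have hF1 : ‖F n p.1 p.2‖ ≤ H * (C ^ 2 * S p.2) := by
      simp only [hF]
      rw [norm_mul, norm_mul]
      calc _ ≤ H * (C ^ 2 * S p.2) * 1 := by
            refine mul_le_mul (mul_le_mul (hH _) (hwb _ _) (norm_nonneg _) hH0) ?_ (norm_nonneg _)
              (mul_nonneg hH0 (mul_nonneg (sq_nonneg _) (hS0 _)))
            by_cases hA' : B p.1 p.2 ∈ A n <;> simp [hA']
        _ = _ := mul_one _
    calc _ ≤ E p.2 * (H * (C ^ 2 * S p.2)) := by gcongr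
      _ = G p.2 := by simp only [hG]; ring
  have e1 : ∫ ω, Z n ω ∂P = (2 * δ n)⁻¹ * ∫ s in (0 : ℝ)..1, ∫ ω, E ω * F n s ω ∂P := by
    rw [intervalIntegral_integral_swap hFint, ← integral_const_mul]
    congr 1
    funext ω
    rw [intervalIntegral.integral_const_mul]
    simp only [hZ]
    ring
  have e2 : ∫ s in (0 : ℝ)..1, ∫ ω, E ω * F n s ω ∂P =
      ∫ s in (0 : ℝ)..1, Real.exp (scalarProd (covOp k) k / 2) * ∫ z in (a - δ n)..(a + δ n), Φ s z := by
    refine intervalIntegral.integral_congr_ae (Eventually.of_forall fun s hs => ?_)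
    rw [uIoc_of_le zero_le_one] at hs
    have h1 := hB.integral_exp_mul_indicator hk (hms s) hs (hAm n)
    rw [hvar] at h1
    rw [intervalIntegral.integral_of_le hle]
    simp only [hΦ]
    rw [integral_const_mul]
    have h2 : ∀ ω, E ω * F n s ω = h s * (Real.exp (scalarProd (fun σ => B σ ω) k) *
        ((A n).indicator 1 (B s ω) * (scalarProd (fun σ => B σ ω) (m s) ^ 2 - v s))) := fun ω => by
      simp only [hE, hF, hw]; ring
    simp_rw [h2]
    rw [integral_const_mul, h1]
    ring
  rw [e1, e2, intervalIntegral.integral_const_mul, intervalIntegral_swap_of_continuous hΦc,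
    intervalIntegral.integral_of_le hle]
  ring

end Expectation

/-! ### The derivative of `Qk`. -/

section CovarianceDerivative

/-- The derivative of `covOp k` on `(0, 1)`. -/
noncomputable def covDeriv (k : ℝ → ℝ) (θ : ℝ) : ℝ := ∫ σ in θ..1, k σ

lemma continuous_covDeriv {k : ℝ → ℝ} (hk : Continuous k) : Continuous (covDeriv k) := by
  have h : covDeriv k = fun θ => -∫ σ in (1 : ℝ)..θ, k σ := by
    funext θ; rw [covDeriv, intervalIntegral.integral_symm]
  rw [h]
  exact (intervalIntegral.continuous_primitive (fun a b => hk.intervalIntegrable a b) 1).neg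

/-- A formula for `covOp k` on `[0, 1]` that defines a differentiable function on `ℝ`. -/
noncomputable def covExt (k : ℝ → ℝ) (θ : ℝ) : ℝ := (∫ σ in (0 : ℝ)..θ, σ * k σ) + θ * covDeriv k θ

lemma integral_min_mul {f : ℝ → ℝ} (hf : Continuous f) {θ : ℝ} (hθ : θ ∈ Icc (0 : ℝ) 1) :
    covOp f θ = (∫ σ in (0 : ℝ)..θ, σ * f σ) + θ * ∫ σ in θ..1, f σ := by
  unfold covOp
  rw [← intervalIntegral.integral_add_adjacent_intervals (b := θ)
    (Continuous.intervalIntegrable (by fun_prop) _ _)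
    (Continuous.intervalIntegrable (by fun_prop) _ _), ← intervalIntegral.integral_const_mul]
  congr 1
  · refine intervalIntegral.integral_congr fun σ hσ => ?_
    rw [uIcc_of_le hθ.1] at hσ
    simp only [min_eq_right hσ.2]
  · refine intervalIntegral.integral_congr fun σ hσ => ?_
    rw [uIcc_of_le hθ.2] at hσ
    simp only [min_eq_left hσ.1]

lemma covOp_eq_covExt {k : ℝ → ℝ} (hk : Continuous k) {θ : ℝ} (hθ : θ ∈ Icc (0 : ℝ) 1) :
    covOp k θ = covExt k θ := integral_min_mul hk hθ

/-- The terms `θ k_θ` and `-θ k_θ` from the two moving endpoints cancel. -/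
lemma hasDerivAt_covExt {k : ℝ → ℝ} (hk : Continuous k) (θ : ℝ) :
    HasDerivAt (covExt k) (covDeriv k θ) θ := by
  have h1 : HasDerivAt (fun θ => ∫ σ in (0 : ℝ)..θ, σ * k σ) (θ * k θ) θ :=
    (continuous_id.mul hk).integral_hasStrictDerivAt 0 θ |>.hasDerivAt
  have h2 : HasDerivAt (covDeriv k) (-k θ) θ :=
    intervalIntegral.integral_hasDerivAt_left (hk.intervalIntegrable _ _)
      (hk.stronglyMeasurableAtFilter _ _) hk.continuousAt
  refine (h1.add ((hasDerivAt_id θ).mul h2)).congr_deriv ?_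
  simp

lemma deriv_covOp {k : ℝ → ℝ} (hk : Continuous k) {θ : ℝ} (hθ : θ ∈ Ioo (0 : ℝ) 1) :
    deriv (covOp k) θ = covDeriv k θ := by
  refine ((hasDerivAt_covExt hk θ).congr_of_eventuallyEq ?_).deriv
  filter_upwards [Ioo_mem_nhds hθ.1 hθ.2] with x hx
  exact covOp_eq_covExt hk (Ioo_subset_Icc_self hx)

end CovarianceDerivative

/-! ### The limit as `ε` tends to `0`. -/

section MollifierLimits

variable {ρ : ℝ → ℝ}

lemma IsMollifier.eq_zero (hρ : IsMollifier ρ) {x : ℝ} (hx : 1 ≤ |x|) : ρ x = 0 := by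
  refine image_eq_zero_of_notMem_tsupport fun h => ?_
  have h1 := hρ.support h
  exact absurd (abs_lt.2 ⟨h1.1, h1.2⟩) (not_lt.2 hx)

lemma IsMollifier.scaled_eq_zero (hρ : IsMollifier ρ) {ε : ℝ} (hε : 0 < ε) {x : ℝ}
    (hx : ε ≤ |x|) : scaled ρ ε x = 0 := by
  rw [scaled, hρ.eq_zero, mul_zero]
  rwa [abs_div, abs_of_pos hε, one_le_div hε]

lemma IsMollifier.scaled_nonneg (hρ : IsMollifier ρ) {ε : ℝ} (hε : 0 < ε) (x : ℝ) :
    0 ≤ scaled ρ ε x := mul_nonneg (by positivity) (hρ.nonneg _)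

lemma IsMollifier.continuous_scaled (hρ : IsMollifier ρ) (ε : ℝ) : Continuous (scaled ρ ε) := by
  have := hρ.continuous
  unfold scaled
  fun_prop

lemma IsMollifier.integral_Ioc (hρ : IsMollifier ρ) : ∫ x in (-1 : ℝ)..1, ρ x = 1 := by
  refine Eq.trans ?_ hρ.integral
  rw [intervalIntegral.integral_of_le (by norm_num)]
  refine setIntegral_eq_integral_of_forall_compl_eq_zero fun x hx => ?_
  refine image_eq_zero_of_notMem_tsupport fun h => hx ?_
  exact Ioo_subset_Ioc_self (hρ.support h)

/-- Symmetry splits the unit mass equally; this is the source of the constant `1/2` in the limit. -/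
lemma IsMollifier.integral_right (hρ : IsMollifier ρ) {y : ℝ} (hy : 1 ≤ y) :
    ∫ x in (0 : ℝ)..y, ρ x = 1 / 2 := by
  have hi : ∀ a b, IntervalIntegrable ρ volume a b := fun a b => hρ.continuous.intervalIntegrable a b
  have h1 : ∫ x in (0 : ℝ)..1, ρ x = 1 / 2 := by
    have h2 := intervalIntegral.integral_add_adjacent_intervals (hi (-1) 0) (hi 0 1)
    have h3 : ∫ x in (-1 : ℝ)..0, ρ x = ∫ x in (0 : ℝ)..1, ρ x := by
      have := intervalIntegral.integral_comp_neg (a := 0) (b := 1) ρ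
      simp only [hρ.symm, neg_zero] at this
      exact this.symm
    rw [hρ.integral_Ioc, h3] at h2
    linarith
  rw [← intervalIntegral.integral_add_adjacent_intervals (hi 0 1) (hi 1 y), h1,
    intervalIntegral.integral_zero_ae, add_zero]
  refine Eventually.of_forall fun x hx => ?_
  rw [uIoc_of_le hy] at hx
  exact hρ.eq_zero (hx.1.le.trans (le_abs_self x))

lemma IsMollifier.integral_left (hρ : IsMollifier ρ) {y : ℝ} (hy : 1 ≤ y) :
    ∫ x in (-y)..0, ρ x = 1 / 2 := by
  have := intervalIntegral.integral_comp_neg (a := 0) (b := y) ρ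
  simp only [hρ.symm, neg_zero] at this
  rw [← this, hρ.integral_right hy]

lemma integral_scaled (ρ : ℝ → ℝ) {ε : ℝ} (hε : 0 < ε) (s a b : ℝ) :
    ∫ σ in a..b, scaled ρ ε (σ - s) = ∫ x in ((a - s) / ε)..((b - s) / ε), ρ x := by
  unfold scaled
  rw [intervalIntegral.integral_const_mul,
    intervalIntegral.integral_comp_sub_right (fun x => ρ (x / ε)) s,
    intervalIntegral.integral_comp_div _ hε.ne', smul_eq_mul]
  field_simp

lemma IsMollifier.integral_scaled_left (hρ : IsMollifier ρ) {ε s : ℝ} (hε : 0 < ε) (hs : ε ≤ s) :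
    ∫ σ in (0 : ℝ)..s, scaled ρ ε (σ - s) = 1 / 2 := by
  rw [integral_scaled ρ hε, sub_self, zero_div, zero_sub, neg_div]
  exact hρ.integral_left ((one_le_div hε).2 hs)

lemma IsMollifier.integral_scaled (hρ : IsMollifier ρ) {ε s : ℝ} (hε : 0 < ε) (hs : ε ≤ s)
    (hs1 : s ≤ 1 - ε) : ∫ σ in (0 : ℝ)..1, scaled ρ ε (σ - s) = 1 := by
  have hc := hρ.continuous_scaled ε
  rw [← intervalIntegral.integral_add_adjacent_intervals (b := s)
    (Continuous.intervalIntegrable (by fun_prop) _ _)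
    (Continuous.intervalIntegrable (by fun_prop) _ _), hρ.integral_scaled_left hε hs,
    RenormalizedWhiteNoise.integral_scaled ρ hε, sub_self, zero_div,
    hρ.integral_right ((one_le_div hε).2 (by linarith))]
  norm_num

/-- Integration by parts, the kernel being minus the `σ`-derivative of `ρ_ε(σ - s)`. Boundary terms
are kept because an endpoint may be `s` itself. -/
lemma IsMollifier.integral_mul_derivKernel (hρ : IsMollifier ρ) (ε s a b : ℝ) {f f' : ℝ → ℝ}
    (hf : ∀ x, HasDerivAt f (f' x) x) (hf' : Continuous f') :
    ∫ σ in a..b, f σ * derivKernel ρ ε s σ = f a * scaled ρ ε (a - s) - f b * scaled ρ ε (b - s) +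
      ∫ σ in a..b, f' σ * scaled ρ ε (σ - s) := by
  have hk : Continuous (derivKernel ρ ε s) :=
    (hρ.continuous_derivKernel ε).comp (f := fun σ : ℝ => (s, σ)) (by fun_prop)
  have hv : ∀ σ, HasDerivAt (fun σ => -scaled ρ ε (σ - s)) (derivKernel ρ ε s σ) σ := by
    intro σ
    unfold scaled derivKernel
    have h1 : HasDerivAt (fun σ : ℝ => (σ - s) / ε) (1 / ε) σ :=
      ((hasDerivAt_id σ).sub_const s).div_const ε
    refine (((hρ.hasDerivAt _).comp σ h1).const_mul (1 / ε)).neg.congr_deriv ?_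
    ring
  rw [intervalIntegral.integral_mul_deriv_eq_deriv_mul (fun x _ => hf x) (fun x _ => hv x)
    (hf'.intervalIntegrable _ _) (hk.intervalIntegrable _ _)]
  simp only [mul_neg, intervalIntegral.integral_neg]
  ring

/-- `E[Ḃ_{ε,s} B_s] = 1/2`. -/
lemma IsMollifier.covOp_derivKernel (hρ : IsMollifier ρ) {ε s : ℝ} (hε : 0 < ε) (hs : ε ≤ s)
    (hs1 : s ≤ 1 - ε) : covOp (derivKernel ρ ε s) s = 1 / 2 := by
  have hk : Continuous (derivKernel ρ ε s) :=
    (hρ.continuous_derivKernel ε).comp (f := fun σ : ℝ => (s, σ)) (by fun_prop)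
  rw [integral_min_mul hk ⟨by linarith, by linarith⟩]
  -- Split `min s σ` at `σ = s`: the boundary terms `∓ s ρ_ε(0)` cancel, leaving half the mass of
  -- `ρ_ε`.
  have h1 := hρ.integral_mul_derivKernel ε s 0 s (f := fun x => x) (f' := fun _ => 1)
    (fun x => hasDerivAt_id x) continuous_const
  have h2 := hρ.integral_mul_derivKernel ε s s 1 (f := fun _ => 1) (f' := fun _ => 0)
    (fun x => hasDerivAt_const x 1) continuous_const
  simp only [one_mul, zero_mul, intervalIntegral.integral_zero, add_zero] at h1 h2
  rw [h1, h2, hρ.integral_scaled_left hε hs,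
    hρ.scaled_eq_zero hε (x := 1 - s) (by rw [abs_of_nonneg] <;> linarith)]
  ring

lemma IsMollifier.scalarProd_derivKernel (hρ : IsMollifier ρ) {ε s : ℝ} (hε : 0 < ε) (hs : ε ≤ s)
    (hs1 : s ≤ 1 - ε) {k : ℝ → ℝ} (hk : Continuous k) :
    scalarProd (covOp k) (derivKernel ρ ε s) =
      ∫ σ in (0 : ℝ)..1, covDeriv k σ * scaled ρ ε (σ - s) := by
  have h1 := hρ.integral_mul_derivKernel ε s 0 1 (hasDerivAt_covExt hk) (continuous_covDeriv hk)
  rw [hρ.scaled_eq_zero hε (x := 1 - s) (by rw [abs_of_nonneg] <;> linarith),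
    hρ.scaled_eq_zero hε (x := 0 - s) (by rw [abs_of_nonpos] <;> linarith), mul_zero, mul_zero,
    sub_zero, zero_add] at h1
  rw [← h1]
  refine intervalIntegral.integral_congr fun σ hσ => ?_
  rw [uIcc_of_le zero_le_one] at hσ
  simp only [covOp_eq_covExt hk hσ]

/-- Away from the endpoints `ρ_ε(· - s)` is a probability density on `[0,1]`. Taking `c = 0` gives
the domination, `c = g s` the convergence. -/
lemma IsMollifier.abs_integral_mul_scaled_sub_le (hρ : IsMollifier ρ) {ε s : ℝ} (hε : 0 < ε)
    (hs : ε ≤ s) (hs1 : s ≤ 1 - ε) {g : ℝ → ℝ} (hg : Continuous g) {c M : ℝ}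
    (hM : ∀ σ ∈ Icc (0 : ℝ) 1, |σ - s| < ε → |g σ - c| ≤ M) :
    |(∫ σ in (0 : ℝ)..1, g σ * scaled ρ ε (σ - s)) - c| ≤ M := by
  have hc := hρ.continuous_scaled ε
  have h1 := hρ.integral_scaled hε hs hs1
  have h2 : (∫ σ in (0 : ℝ)..1, g σ * scaled ρ ε (σ - s)) - c =
      ∫ σ in (0 : ℝ)..1, (g σ - c) * scaled ρ ε (σ - s) := by
    simp_rw [sub_mul]
    rw [intervalIntegral.integral_sub (Continuous.intervalIntegrable (by fun_prop) _ _)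
      (Continuous.intervalIntegrable (by fun_prop) _ _), intervalIntegral.integral_const_mul, h1,
      mul_one]
  have h3 := intervalIntegral.norm_integral_le_of_norm_le (a := 0) (b := 1) (μ := volume)
    (f := fun σ => (g σ - c) * scaled ρ ε (σ - s)) (g := fun σ => M * scaled ρ ε (σ - s))
    zero_le_one (Eventually.of_forall fun σ hσ => by
      rw [norm_mul, Real.norm_eq_abs, Real.norm_of_nonneg (hρ.scaled_nonneg hε _)]
      by_cases h : |σ - s| < ε
      · exact mul_le_mul_of_nonneg_right (hM σ (Ioc_subset_Icc_self hσ) h) (hρ.scaled_nonneg hε _)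
      · rw [hρ.scaled_eq_zero hε (not_lt.1 h), mul_zero, mul_zero])
    (Continuous.intervalIntegrable (by fun_prop) _ _)
  rw [intervalIntegral.integral_const_mul, h1, mul_one] at h3
  rw [h2]
  exact h3

/-- `wickDensity` for the regularised derivative converges to the density with `λ`. -/
lemma IsMollifier.tendsto_integral_wickDensity (hρ : IsMollifier ρ) {k h : ℝ → ℝ}
    (hk : Continuous k) (hcont : Continuous h) (hcpt : HasCompactSupport h)
    (hsupp : tsupport h ⊆ Ioo 0 1) (a : ℝ) :
    Tendsto (fun ε => ∫ s in (0 : ℝ)..1, h s * wickDensity k (derivKernel ρ ε s) s a) (𝓝[>] 0)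
      (𝓝 (∫ θ in (0 : ℝ)..1, h θ * (Real.exp (-(a - covOp k θ) ^ 2 / (2 * θ)) /
        Real.sqrt (2 * Real.pi * θ)) * lam θ (deriv (covOp k) θ) (a - covOp k θ))) := by
  obtain ⟨η, hη, hηs⟩ := exists_pos_le_of_tsupport_subset hcpt hsupp
  have hg := continuous_covDeriv hk
  have hK := continuous_covOp hk
  obtain ⟨M, hM⟩ := isCompact_Icc.exists_bound_of_continuousOn (hg.continuousOn (s := Icc (0 : ℝ) 1))
  set q : ℝ → ℝ := fun s => gaussianPDFReal (covOp k s) s.toNNReal a with hq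
  have hq0 : ∀ s, 0 ≤ q s := fun s => gaussianPDFReal_nonneg _ _ _
  have hformula : ∀ ε, 0 < ε → ε < η → ∀ s ∈ tsupport h, wickDensity k (derivKernel ρ ε s) s a =
      q s * (((∫ σ in (0 : ℝ)..1, covDeriv k σ * scaled ρ ε (σ - s)) +
        1 / 2 / s * (a - covOp k s)) ^ 2 - (1 / 2 / s) ^ 2 * s) := by
    intro ε hε hεη s hs
    have h1 : ε ≤ s := hεη.le.trans (hηs s hs).1
    have h2 : s ≤ 1 - ε := by linarith [(hηs s hs).2]
    rw [wickDensity, hρ.covOp_derivKernel hε h1 h2, hρ.scalarProd_derivKernel hε h1 h2 hk]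
  -- The dominating function, from `(x + y)² ≤ 2x² + 2y²` with `|x| ≤ M` for the mollified `K'`.
  set b : ℝ → ℝ := fun s => h s * (q s * (2 * M ^ 2 + 2 * (1 / 2 / s * (a - covOp k s)) ^ 2 +
    (1 / 2 / s) ^ 2 * s)) with hb
  have hbc : Continuous b := by
    refine continuous_of_tsupport fun s hs => ?_
    have hs0 : 0 < s := (hsupp (tsupport_mul_subset_left hs)).1
    have hmax : 0 < max s 0 := lt_max_of_lt_left hs0
    have hmc : ContinuousAt (fun p : ℝ => max p 0) s :=
      (continuous_id.max continuous_const).continuousAt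
    have hd : ContinuousAt (fun p : ℝ => 1 / 2 / p) s :=
      ContinuousAt.div (by fun_prop) (by fun_prop) hs0.ne'
    simp only [hb, hq, gaussianPDFReal_def, Real.coe_toNNReal']
    refine ContinuousAt.mul (by fun_prop) (ContinuousAt.mul (ContinuousAt.mul ?_ ?_) ?_)
    · refine ContinuousAt.inv₀ (by fun_prop) ?_
      positivity
    · refine (ContinuousAt.div (by fun_prop) (by fun_prop) ?_).rexp
      positivity
    · fun_prop
  have hsmall : ∀ᶠ ε in 𝓝[>] (0 : ℝ), 0 < ε ∧ ε < η := by
    filter_upwards [Ioo_mem_nhdsGT hη] with ε hε using hε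
  have hlim := intervalIntegral.tendsto_integral_filter_of_dominated_convergence (μ := volume)
    (a := 0) (b := 1) (l := 𝓝[>] (0 : ℝ))
    (F := fun ε s => h s * wickDensity k (derivKernel ρ ε s) s a)
    (f := fun s => h s * (q s * ((covDeriv k s + 1 / 2 / s * (a - covOp k s)) ^ 2 -
      (1 / 2 / s) ^ 2 * s))) (fun s => |b s|) ?_ ?_ ?_ ?_
  · refine hlim.congr' EventuallyEq.rfl |>.trans (le_of_eq ?_)
    congr 1
    refine intervalIntegral.integral_congr fun s _ => ?_
    by_cases hs : s ∈ tsupport h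
    · have hs0 : 0 < s := (hsupp hs).1
      simp only [hq, gaussianPDFReal_def, Real.coe_toNNReal _ hs0.le, deriv_covOp hk (hsupp hs), lam]
      field_simp
      ring
    · simp [image_eq_zero_of_notMem_tsupport hs]
  · refine Eventually.of_forall fun ε => Continuous.aestronglyMeasurable ?_
    exact (continuous_mul_wickDensity hk (hρ.continuous_derivKernel ε) hcont hsupp).comp
      (f := fun s : ℝ => (s, a)) (by fun_prop)
  · filter_upwards [hsmall] with ε hε
    refine Eventually.of_forall fun s _ => ?_
    by_cases hs : s ∈ tsupport h
    · have hs0 : 0 < s := (hsupp hs).1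
      have h1 : ε ≤ s := hε.2.le.trans (hηs s hs).1
      have h2 : s ≤ 1 - ε := by linarith [(hηs s hs).2, hε.2]
      have h3 := hρ.abs_integral_mul_scaled_sub_le hε.1 h1 h2 hg (c := 0) (M := M)
        (fun σ hσ _ => by simpa using hM σ hσ)
      rw [sub_zero] at h3
      rw [hformula ε hε.1 hε.2 s hs, norm_mul, norm_mul, hb, abs_mul, abs_mul, ← Real.norm_eq_abs,
        ← Real.norm_eq_abs]
      refine mul_le_mul_of_nonneg_left (mul_le_mul_of_nonneg_left ?_ (norm_nonneg _)) (norm_nonneg _)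
      rw [Real.norm_eq_abs]
      set x := ∫ σ in (0 : ℝ)..1, covDeriv k σ * scaled ρ ε (σ - s) with hx
      set y := 1 / 2 / s * (a - covOp k s) with hy
      have h4 : x ^ 2 ≤ M ^ 2 := sq_le_sq.2 (h3.trans (le_abs_self M))
      have h5 : 0 ≤ (1 / 2 / s) ^ 2 * s := by positivity
      refine le_trans ?_ (le_abs_self _)
      rw [abs_le]
      constructor <;> nlinarith [sq_nonneg (x + y), sq_nonneg (x - y)]
    · simp [image_eq_zero_of_notMem_tsupport hs]
  · exact Continuous.intervalIntegrable (by fun_prop) _ _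
  · refine Eventually.of_forall fun s _ => ?_
    by_cases hs : s ∈ tsupport h
    · have hκ : Tendsto (fun ε => ∫ σ in (0 : ℝ)..1, covDeriv k σ * scaled ρ ε (σ - s)) (𝓝[>] 0)
          (𝓝 (covDeriv k s)) := by
        rw [Metric.tendsto_nhds]
        intro e he
        obtain ⟨r, hr, hgr⟩ := Metric.continuous_iff.1 hg s (e / 2) (by positivity)
        filter_upwards [hsmall, Ioo_mem_nhdsGT hr] with ε hε hεr
        have h1 : ε ≤ s := hε.2.le.trans (hηs s hs).1
        have h2 : s ≤ 1 - ε := by linarith [(hηs s hs).2, hε.2]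
        refine lt_of_le_of_lt (hρ.abs_integral_mul_scaled_sub_le hε.1 h1 h2 hg (M := e / 2)
          (fun σ _ hσ => (hgr σ (hσ.trans hεr.2)).le)) (by linarith)
      refine ((((hκ.add_const _).pow 2).sub_const _).const_mul _ |>.const_mul _).congr' ?_
      filter_upwards [hsmall] with ε hε
      rw [hformula ε hε.1 hε.2 s hs]
    · simp [image_eq_zero_of_notMem_tsupport hs]

end MollifierLimits

/-! ### Passing to a regular modification. -/

section Modification

variable {Ω : Type*} [MeasurableSpace Ω] {P : Measure Ω} {B B' : ℝ → Ω → ℝ}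

lemma IsBrownianOnUnit.congr (hB : IsBrownianOnUnit B P)
    (h : ∀ᵐ ω ∂P, ∀ θ ∈ Icc (0 : ℝ) 1, B θ ω = B' θ ω) : IsBrownianOnUnit B' P := by
  have hθ : ∀ θ ∈ Icc (0 : ℝ) 1, B θ =ᵐ[P] B' θ := fun θ hθ => by
    filter_upwards [h] with ω hω using hω θ hθ
  have hmean : ∀ θ ∈ Icc (0 : ℝ) 1, ∫ ω, B' θ ω ∂P = ∫ ω, B θ ω ∂P := fun θ hθ' =>
    (integral_congr_ae (hθ θ hθ')).symm
  refine ⟨hB.gaussian.congr fun t => hθ t t.2, fun θ hθ' => ?_, fun θ h1 θ' h2 => ?_, ?_⟩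
  · rw [hmean θ hθ', hB.mean θ hθ']
  · rw [← hB.cov θ h1 θ' h2]
    unfold covariance
    rw [hmean θ h1, hmean θ' h2]
    refine integral_congr_ae ?_
    filter_upwards [h] with ω hω
    rw [hω θ h1, hω θ' h2]
  · filter_upwards [h, hB.cont] with ω hω hc
    exact hc.congr fun θ hθ' => (hω θ hθ').symm

lemma IsLocalTime.congr {L : ℝ → ℝ → Ω → ℝ} (hL : IsLocalTime B L P)
    (h : ∀ᵐ ω ∂P, ∀ θ ∈ Icc (0 : ℝ) 1, B θ ω = B' θ ω) : IsLocalTime B' L P := by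
  refine ⟨hL.aemeasurable, hL.cont, hL.mono, hL.zero, ?_⟩
  filter_upwards [h, hL.occupation] with ω hω hocc ψ hψ hb θ hθ
  rw [← hocc ψ hψ hb θ hθ]
  refine intervalIntegral.integral_congr fun s hs => ?_
  rw [uIcc_of_le hθ.1] at hs
  simp only [hω s ⟨hs.1, hs.2.trans hθ.2⟩]

/-- Set the process to zero on a measurable null set outside which paths are continuous and agree
with measurable versions at countably many times. Measurability at the remaining times follows by
limits along rationals. -/
lemma IsBrownianOnUnit.exists_isRegularBrownian (hB : IsBrownianOnUnit B P) :
    ∃ B' : ℝ → Ω → ℝ, IsRegularBrownian B' P ∧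
      ∀ᵐ ω ∂P, ∀ θ ∈ Icc (0 : ℝ) 1, B θ ω = B' θ ω := by
  have hm : ∀ t : Icc (0 : ℝ) 1, AEMeasurable (B t) P := fun t => hB.gaussian.aemeasurable t
  set r : ℝ → Icc (0 : ℝ) 1 := projIcc 0 1 zero_le_one with hr
  set S : Set Ω := {ω | (∀ q : ℚ, B (r q) ω = (hm (r q)).mk _ ω) ∧
    ContinuousOn (fun θ => B θ ω) (Icc 0 1)} with hS
  have hSae : ∀ᵐ ω ∂P, ω ∈ S := by
    filter_upwards [ae_all_iff.2 fun q : ℚ => (hm (r q)).ae_eq_mk, hB.cont] with ω h1 h2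
    exact ⟨h1, h2⟩
  set N := toMeasurable P Sᶜ with hN
  have hNm : MeasurableSet N := measurableSet_toMeasurable _ _
  have hN0 : P N = 0 := by rw [hN, measure_toMeasurable]; exact hSae
  have hNS : ∀ ω, ω ∉ N → ω ∈ S := fun ω hω => by
    by_contra h
    exact hω (subset_toMeasurable P Sᶜ h)
  have hNae : ∀ᵐ ω ∂P, ω ∉ N := measure_eq_zero_iff_ae_notMem.1 hN0
  set B' : ℝ → Ω → ℝ := fun θ => Nᶜ.indicator (B (r θ)) with hB'
  have heq : ∀ᵐ ω ∂P, ∀ θ ∈ Icc (0 : ℝ) 1, B θ ω = B' θ ω := by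
    filter_upwards [hNae] with ω hω θ hθ
    have hω' : ω ∈ Nᶜ := hω
    simp only [hB', indicator_of_mem hω', hr, projIcc_of_mem zero_le_one hθ]
  have hpath : ∀ ω, Continuous fun θ => B' θ ω := by
    intro ω
    by_cases hω : ω ∈ N
    · have hω' : ω ∉ Nᶜ := fun h => h hω
      simp only [hB', indicator_of_notMem hω']
      exact continuous_const
    · have hω' : ω ∈ Nᶜ := hω
      simp only [hB', indicator_of_mem hω']
      exact (hNS ω hω).2.comp_continuous (continuous_subtype_val.comp continuous_projIcc)
        fun θ => (r θ).2
  have hq : ∀ q : ℚ, Measurable (B' q) := by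
    intro q
    have h1 : B' q = Nᶜ.indicator ((hm (r q)).mk _) := by
      funext ω
      by_cases hω : ω ∈ N
      · have hω' : ω ∉ Nᶜ := fun h => h hω
        simp only [hB', indicator_of_notMem hω']
      · have hω' : ω ∈ Nᶜ := hω
        simp only [hB', indicator_of_mem hω']
        exact (hNS ω hω).1 q
    rw [h1]
    exact (hm (r q)).measurable_mk.indicator hNm.compl
  refine ⟨B', ⟨hB.congr heq, fun θ => ?_, hpath⟩, heq⟩
  obtain ⟨u, hu, hulim⟩ := mem_closure_iff_seq_limit.1 (Rat.denseRange_cast (𝕜 := ℝ) θ)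
  choose q hqu using hu
  refine measurable_of_tendsto_metrizable (f := fun n => B' (u n)) (fun n => ?_)
    (tendsto_pi_nhds.2 fun ω => ((hpath ω).tendsto θ).comp hulim)
  rw [← hqu n]
  exact hq _

lemma regularize_congr (ρ : ℝ → ℝ) (ε : ℝ) {ℓ ℓ' : ℝ → ℝ} (h : ∀ θ ∈ Icc (0 : ℝ) 1, ℓ θ = ℓ' θ) :
    regularize ρ ε ℓ = regularize ρ ε ℓ' := by
  funext θ
  refine intervalIntegral.integral_congr fun σ hσ => ?_
  rw [uIcc_of_le zero_le_one] at hσ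
  simp only [h σ hσ]

lemma scalarProd_congr {f f' g g' : ℝ → ℝ} (hf : ∀ θ ∈ Icc (0 : ℝ) 1, f θ = f' θ)
    (hg : ∀ θ ∈ Icc (0 : ℝ) 1, g θ = g' θ) : scalarProd f g = scalarProd f' g' := by
  refine intervalIntegral.integral_congr fun σ hσ => ?_
  rw [uIcc_of_le zero_le_one] at hσ
  simp only [hf σ hσ, hg σ hσ]

lemma covOp_congr {k k' : ℝ → ℝ} (h : ∀ θ ∈ Icc (0 : ℝ) 1, k θ = k' θ) : covOp k = covOp k' := by
  funext θ
  refine intervalIntegral.integral_congr fun σ hσ => ?_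
  rw [uIcc_of_le zero_le_one] at hσ
  simp only [h σ hσ]

lemma IsRegularBrownian.wickLocalTimeIntegral_eq (hB' : IsRegularBrownian B' P)
    (heq : ∀ᵐ ω ∂P, ∀ θ ∈ Icc (0 : ℝ) 1, B θ ω = B' θ ω) {ρ : ℝ → ℝ} (hρ : IsMollifier ρ)
    (ε : ℝ) (L : ℝ → ℝ → Ω → ℝ) (h : ℝ → ℝ) (a : ℝ) :
    wickLocalTimeIntegral P ρ ε B L h a =ᵐ[P] wickIntegral P B' L (derivKernel ρ ε) h a := by
  have h1 : ∀ᵐ ω ∂P, ∀ θ, regDeriv ρ ε B θ ω =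
      scalarProd (fun σ => B' σ ω) (derivKernel ρ ε θ) := by
    filter_upwards [heq] with ω hω θ
    rw [regDeriv, regularize_congr ρ ε hω, hρ.deriv_regularize ε (hB'.path ω)]
  filter_upwards [h1] with ω hω
  unfold wickLocalTimeIntegral wickIntegral
  congr 1
  funext θ
  have h2 : ∫ ω', regDeriv ρ ε B θ ω' ^ 2 ∂P =
      ∫ ω', scalarProd (fun σ => B' σ ω') (derivKernel ρ ε θ) ^ 2 ∂P := by
    refine integral_congr_ae ?_
    filter_upwards [h1] with ω' hω'
    rw [hω' θ]
  rw [wickSq, hω θ, h2]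

end Modification

end RenormalizedWhiteNoise

theorem corollary3p4 {Ω : Type*} [MeasurableSpace Ω] (P : Measure Ω) [IsProbabilityMeasure P]
    (B : ℝ → Ω → ℝ) (hB : RenormalizedWhiteNoise.IsBrownianOnUnit B P)
    (L : ℝ → ℝ → Ω → ℝ) (hL : RenormalizedWhiteNoise.IsLocalTime B L P)
    (a : ℝ)
    (h : ℝ → ℝ) (hcont : Continuous h) (hcpt : HasCompactSupport h)
    (hsupp : tsupport h ⊆ Ioo 0 1)
    (k : ℝ → ℝ) (hk : ContinuousOn k (Icc 0 1)) (hk0 : k 0 = 0) :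
    RenormalizedWhiteNoise.HasRenormalizedExpectation P B L h a
      (fun w => Real.exp (RenormalizedWhiteNoise.scalarProd w k))
      (Real.exp (RenormalizedWhiteNoise.scalarProd (RenormalizedWhiteNoise.covOp k) k / 2) *
        ∫ θ in (0 : ℝ)..1,
          h θ *
            (Real.exp (-(a - RenormalizedWhiteNoise.covOp k θ) ^ 2 / (2 * θ)) /
              Real.sqrt (2 * Real.pi * θ)) *
            RenormalizedWhiteNoise.lam θ (deriv (RenormalizedWhiteNoise.covOp k) θ)
              (a - RenormalizedWhiteNoise.covOp k θ)) := by
  open RenormalizedWhiteNoise in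
  obtain ⟨B', hB', heq⟩ := hB.exists_isRegularBrownian
  have hL' := hL.congr heq
  -- `k` is continuous only on `[0,1]`; its constant extension is continuous on `ℝ` and changes none
  -- of the integrals.
  set k' : ℝ → ℝ := fun x => k (projIcc 0 1 zero_le_one x) with hk'def
  have hk' : Continuous k' :=
    hk.comp_continuous (continuous_subtype_val.comp continuous_projIcc) fun θ => (projIcc _ _ _ θ).2
  have hkk' : ∀ θ ∈ Icc (0 : ℝ) 1, k θ = k' θ := fun θ hθ => by
    simp only [hk'def, projIcc_of_mem zero_le_one hθ]
  rw [covOp_congr hkk', scalarProd_congr (fun _ _ => rfl) hkk']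
  intro ρ hρ
  have hae : ∀ ε, (fun ω => Real.exp (scalarProd (fun θ => B θ ω) k) *
      wickLocalTimeIntegral P ρ ε B L h a ω) =ᵐ[P]
      fun ω => Real.exp (scalarProd (fun σ => B' σ ω) k') *
        wickIntegral P B' L (derivKernel ρ ε) h a ω := by
    intro ε
    filter_upwards [heq, hB'.wickLocalTimeIntegral_eq heq hρ ε L h a] with ω h1 h2
    rw [h2, scalarProd_congr h1 hkk']
  -- The kernel bound blows up as `ε ↓ 0`, but the formula is exact at each `ε`, so only its
  -- deterministic side has to be passed to the limit.
  have hmain : ∀ ε, _ := fun ε =>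
    have hbound : ∃ C, ∀ s σ, |derivKernel ρ ε s σ| ≤ C := by
      obtain ⟨C, hC⟩ := hρ.exists_bound_deriv
      refine ⟨1 / ε ^ 2 * C, fun s σ => ?_⟩
      rw [derivKernel, abs_mul, abs_neg, abs_of_nonneg (by positivity : (0 : ℝ) ≤ 1 / ε ^ 2)]
      exact mul_le_mul_of_nonneg_left (hC _) (by positivity)
    hB'.integral_exp_mul_wickIntegral hL' a hcont hcpt hsupp hk' (hρ.continuous_derivKernel ε)
      hbound.choose_spec
  refine ⟨fun ε _ => (hmain ε).1.congr (hae ε).symm, ?_⟩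
  refine ((hρ.tendsto_integral_wickDensity hk' hcont hcpt hsupp a).const_mul _).congr fun ε => ?_
  rw [← (hmain ε).2]
  exact (integral_congr_ae (hae ε)).symm
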